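/- Let $\mathbb{F}_q$ be a finite field with $q$ elements, $q$ odd; all representations are complex. Fix a non-trivial character $\psi_0$ of $(\mathbb{F}_q,+)$ and $\gamma\in\mathbb{F}_q^\times$, and put $C=\mathrm{diag}(\gamma,0)$. Let $Sp_4(\mathbb{F}_q)=\{g\in GL_4(\mathbb{F}_q): {}^tgJg=J\}$, $J=\begin{bmatrix}0&I_2\\-I_2&0\end{bmatrix}$. Let $N=\left\{\begin{bmatrix}I_2&X\\0&I_2\end{bmatrix}: {}^tX=X\right\}$, with the character $\psi=\psi_C:\begin{bmatrix}I_2&X\\0&I_2\end{bmatrix}\mapsto\psi_0(\mathrm{tr}(CX))$. Let $$O_2=O_2(\mathbb{F}_q,C)=\{g\in GL_2(\mathbb{F}_q):{}^tgCg=C\}=\left\{\begin{bmatrix}\pm1&0\\y&d\end{bmatrix}: d\in\mathbb{F}_q^\times,\ y\in\mathbb{F}_q\right\},$$ embedded in $Sp_4(\mathbb{F}_q)$ by $g\mapsto\mathrm{diag}(g,{}^tg^{-1})$, let $T_2=T_2(\mathbb{F}_q,C)=\{\mathrm{diag}(\pm1,d)\}\cong\{\pm1\}\times\mathbb{F}_q^\times$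 be its diagonal subgroup, and let $O_2\to T_2$ be the quotient map $\begin{bmatrix}a&0\\y&d\end{bmatrix}\mapsto\mathrm{diag}(a,d)$. For a representation $(\pi,V)$ of a finite group, a subgroup $\mathcal U$ and a character $\theta$ of $\mathcal U$, the twisted Jacquet module $r_{\mathcal U,\theta}(\pi)$ is the quotient of $V$ by the span of all $\pi(u)v-\theta(u)v$ ($u\in\mathcal U$, $v\in V$), with the induced action of any subgroup normalizing $\mathcal U$ and $\theta$; write $r_{\mathcal U}=r_{\mathcal U,1}$. Thus $r_{N,\psi}(\pi)$ is a representation of $O_2$ for every representation $\pi$ of $Sp_4(\mathbb{F}_q)$. In $SL_2(\mathbb{F}_q)$ let $B$ be the upper triangular Borel subgroup, $N_{1,1}$ its unipotent radical and $M_{1,1}=\{\mathrm{diag}(y,y^{-1})\}\cong\mathbb{F}_q^\times$; let $\psi_\gamma$ be the character $\begin{bmatrix}1&x\\0&1\end{bmatrix}\mapsto\psi_0(\gamma x)$ of $N_{1,1}$. Let $\Psi,\Psi'$ be representatives of the two orbits of $M_{1,1}$, acting by conjugation, on the non-trivial characters of $N_{1,1}$. A representation $\tau$ of $SL_2(\mathbb{F}_q)$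 is cuspidal if $r_{N_{1,1}}(\tau)=0$. Let $Q=LU$ be the Klingen parabolic subgroup of $Sp_4(\mathbb{F}_q)$ (the stabilizer of the line spanned by the first basis vector), $L\cong\mathbb{F}_q^\times\times SL_2(\mathbb{F}_q)$. Let $\eta$ be a character of $\mathbb{F}_q^\times$, let $\tau$ be an irreducible representation of $SL_2(\mathbb{F}_q)$ with central character $\omega_\tau$ (a character of $\{\pm1\}$), and put $\Pi=\mathrm{Ind}_Q^{Sp_4(\mathbb{F}_q)}(\eta\otimes\tau)$. Let $\varrho_0$ and $\varrho_1$ be the representations of $O_2$ obtained, via the quotient map, from the representations $\omega_\tau\otimes\eta$, $\mathrm{diag}(a,d)\mapsto\omega_\tau(a)\eta(d)$, and $\eta|_{\{\pm1\}}\otimes r_{N_{1,1}}(\tau)$, $\mathrm{diag}(a,d)\mapsto\eta(a)\,r_{N_{1,1}}(\tau)(\mathrm{diag}(d,d^{-1}))$, of $T_2$, and let $\varrho_2=\omega_\tau\otimes\eta^{-1}$, a representation of $T_2$. Put $$\mu_1=\varrho_0\oplus\varrho_1\oplus\mathrm{Ind}_{T_2}^{O_2}(\varrho_2),\qquad \mu_2=\varrho_0\oplus\mathrm{Ind}_{T_2}^{O_2}(\varrho_2).$$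 Then, as representations of $O_2$: 1. If $\tau$ is one-dimensional (and, in case $q=3$, trivial), then $r_{N,\psi}(\Pi)\cong\varrho_1$. (For $q>3$ the trivial representation is the only one-dimensional representation.) 2. If $\tau$ is an irreducible principal series representation $\mathrm{Ind}_B^{SL_2(\mathbb{F}_q)}(\chi)$, or the special representation (the non-trivial component of $\mathrm{Ind}_B^{SL_2(\mathbb{F}_q)}(1)$), then $r_{N,\psi}(\Pi)\cong\mu_1$. 3. If $\tau$ is cuspidal of dimension $q-1$, then $r_{N,\psi}(\Pi)\cong\mu_2$. 4. Let $\tau=\tau_1$ be the irreducible component of $\mathrm{Ind}_B^{SL_2(\mathbb{F}_q)}(\chi)$, $\chi$ the character of order $2$ of $\mathbb{F}_q^\times$, with $r_{N_{1,1},\Psi}(\tau_1)\ne0$ and $r_{N_{1,1},\Psi'}(\tau_1)=0$. If $\psi_\gamma$ is in the $M_{1,1}$-orbit of $\Psi$, then $r_{N,\psi}(\Pi)\cong\mu_1$; otherwise $r_{N,\psi}(\Pi)\cong\varrho_1$. 5. Let $\tau=\tau_1'$ be the cuspidal irreducible representation of dimension $\frac{q-1}{2}$ with $r_{N_{1,1},\Psi}(\tau_1')\ne0$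 and $r_{N_{1,1},\Psi'}(\tau_1')=0$. If $\psi_\gamma$ is in the $M_{1,1}$-orbit of $\Psi$, then $r_{N,\psi}(\Pi)\cong\mu_2$; otherwise $r_{N,\psi}(\Pi)=0$. -/

import Mathlib

open Matrix

noncomputable section

namespace KlingenJacquet

/-! ### Generalities on complex representations -/

section General

variable {G H : Type*} [Group G] [Group H] {V : Type*} [AddCommGroup V] [Module ℂ V]

/-- The representation `g ↦ χ(g) · ρ(g)`. -/
def charTwist (χ : G →* ℂˣ) (ρ : Representation ℂ G V) : Representation ℂ G V where
  toFun g := (χ g : ℂ) • ρ g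
  map_one' := by simp
  map_mul' g h := by
    ext v
    simp [mul_smul, smul_comm (χ g : ℂ) (χ h : ℂ)]

/-- A character viewed as a one-dimensional representation on `ℂ`. -/
def charRep (χ : G →* ℂˣ) : Representation ℂ G ℂ :=
  charTwist χ (Representation.trivial ℂ G ℂ)

/-- The representation induced from a subgroup: right translation on the functions `f : G → W`
with `f (h * g) = σ h (f g)` for `h` in the subgroup (`G` is a finite group throughout). -/
abbrev induced (S : Subgroup G) (σ : Representation ℂ S V) :
    Representation ℂ G (Representation.coindV S.subtype σ) :=
  Representation.coind S.subtype σ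

/-- `σ` is an irreducible constituent of `π`, for `σ` irreducible and `G` finite. -/
def IsConstituent {W : Type*} [AddCommGroup W] [Module ℂ W]
    (σ : Representation ℂ G V) (π : Representation ℂ G W) : Prop :=
  ∃ f : σ.IntertwiningMap π, Function.Injective f

theorem exists_centralCharacter [Finite G] (ρ : Representation ℂ G V)
    [Representation.IsIrreducible ρ] :
    ∃ ω : Subgroup.center G →* ℂˣ, ∀ (z : Subgroup.center G) (v : V),
      ρ (z : G) v = (ω z : ℂ) • v := by
  classical
  have hnt : Nontrivial V := by
    by_contra hV
    rw [not_nontrivial_iff_subsingleton] at hV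
    obtain ⟨a, b, hab⟩ := (inferInstance : Nontrivial (Subrepresentation ρ))
    apply hab
    ext x
    rw [Subsingleton.elim x 0]
    exact ⟨fun _ => b.toSubmodule.zero_mem, fun _ => a.toSubmodule.zero_mem⟩
  obtain ⟨v₀, hv₀⟩ := exists_ne (0 : V)
  have hfd : FiniteDimensional ℂ V := by
    let S : Subrepresentation ρ :=
      { toSubmodule := Submodule.span ℂ (Set.range fun g => ρ g v₀)
        apply_mem_toSubmodule := by
          intro g v hv
          induction hv using Submodule.span_induction with
          | mem x hx =>
            obtain ⟨h, rfl⟩ := hx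
            exact Submodule.subset_span ⟨g * h, by simp⟩
          | zero => simp
          | add x y _ _ hx hy => rw [map_add]; exact Submodule.add_mem _ hx hy
          | smul c x _ hx => rw [map_smul]; exact Submodule.smul_mem _ _ hx }
    have hmem : v₀ ∈ S.toSubmodule := Submodule.subset_span ⟨1, by simp⟩
    have hS : S = ⊤ := by
      rcases eq_bot_or_eq_top S with h | h
      · rw [h] at hmem
        exact absurd hmem hv₀
      · exact h
    have : (⊤ : Submodule ℂ V) = Submodule.span ℂ (Set.range fun g => ρ g v₀) := by
      have := congrArg Subrepresentation.toSubmodule hS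
      exact this.symm
    exact ⟨this ▸ Submodule.fg_span (Set.finite_range _)⟩
  have hs : ∀ z : Subgroup.center G, ∃ c : ℂ, ∀ v, ρ (z : G) v = c • v := by
    intro z
    obtain ⟨c, hc⟩ :=
      (Representation.IsIrreducible.algebraMap_intertwiningMap_bijective_of_isAlgClosed
        (ρ := ρ)).2
        (Representation.IntertwiningMap.centralMul ρ (z : G) z.2)
    refine ⟨c, fun v => ?_⟩
    have := congrArg (fun f : ρ.IntertwiningMap ρ => f v) hc
    exact this.symm
  choose c hc using hs
  have hinj : ∀ a b : ℂ, a • v₀ = b • v₀ → a = b := fun a b h => smul_left_injective ℂ hv₀ h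
  let χ : Subgroup.center G →* ℂ :=
    { toFun := c
      map_one' := hinj _ _ (by rw [← hc]; simp)
      map_mul' := fun x y => hinj _ _ (by
        rw [← hc, mul_smul, ← hc y, ← hc x]; simp) }
  exact ⟨χ.toHomUnits, fun z v => hc z v⟩

open Classical in
/-- The central character of `ρ`; the default value `1` is never used when `ρ` is an irreducible
representation of a finite group. -/
def centralCharacter (ρ : Representation ℂ G V) : Subgroup.center G →* ℂˣ :=
  if h : ∃ ω : Subgroup.center G →* ℂˣ, ∀ (z : Subgroup.center G) (v : V),
      ρ (z : G) v = (ω z : ℂ) • v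
  then h.choose else 1

theorem centralCharacter_spec [Finite G] (ρ : Representation ℂ G V)
    [Representation.IsIrreducible ρ] (z : Subgroup.center G) (v : V) :
    ρ (z : G) v = (centralCharacter ρ z : ℂ) • v := by
  have h := exists_centralCharacter ρ
  rw [centralCharacter, dif_pos h]
  exact h.choose_spec z v

/-- The subgroup of `G` normalizing the subgroup `U` and stabilizing the character `θ` of `U`. -/
def charStabilizer (U : Subgroup G) (θ : U →* ℂ) : Subgroup G where
  carrier := {g | (∀ u : G, u ∈ U ↔ g * u * g⁻¹ ∈ U) ∧
    ∀ u u' : U, (u' : G) = g * u * g⁻¹ → θ u' = θ u}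
  one_mem' := by
    refine ⟨by simp, fun u u' h => ?_⟩
    have : u' = u := Subtype.ext (by simpa using h)
    rw [this]
  mul_mem' := by
    rintro a b ⟨ha, ha'⟩ ⟨hb, hb'⟩
    refine ⟨fun u => ?_, fun u u' h => ?_⟩
    · rw [hb u, ha]
      simp [mul_assoc]
    · have h1 := ha' ⟨b * u * b⁻¹, (hb u).1 u.2⟩ u' (by rw [h]; simp [mul_assoc])
      rw [h1]
      exact hb' u _ rfl
  inv_mem' := by
    rintro a ⟨ha, ha'⟩
    refine ⟨fun u => ?_, fun u u' h => ?_⟩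
    · rw [ha (a⁻¹ * u * a⁻¹⁻¹)]
      simp [mul_assoc]
    · exact (ha' u' u (by rw [h]; simp [mul_assoc])).symm

/-- The span `V(U, θ)` of the vectors `ρ(u) v - θ(u) v`. -/
def twistedKer (ρ : Representation ℂ G V) (U : Subgroup G) (θ : U →* ℂ) : Submodule ℂ V :=
  Submodule.span ℂ {x | ∃ (u : U) (v : V), x = ρ (u : G) v - θ u • v}

/-- The space `V / V(U, θ)` of the twisted Jacquet module. -/
abbrev JacquetSpace (ρ : Representation ℂ G V) (U : Subgroup G) (θ : U →* ℂ) : Type _ :=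
  V ⧸ twistedKer ρ U θ

theorem twistedKer_le_comap (ρ : Representation ℂ G V) (U : Subgroup G) (θ : U →* ℂ)
    (m : charStabilizer U θ) :
    twistedKer ρ U θ ≤ (twistedKer ρ U θ).comap ((ρ.comp (charStabilizer U θ).subtype) m) := by
  refine Submodule.span_le.2 ?_
  rintro _ ⟨u, v, rfl⟩
  obtain ⟨m, hm, hm'⟩ := m
  have h1 : θ ⟨m * u * m⁻¹, (hm u).1 u.2⟩ = θ u := hm' u _ rfl
  refine Submodule.subset_span ⟨⟨m * u * m⁻¹, (hm u).1 u.2⟩, ρ m v, ?_⟩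
  rw [h1]
  simp [← Module.End.mul_apply, ← map_mul]

/-- The twisted Jacquet module `r_{U,θ}(ρ)` as a representation of the group of all elements
normalizing `U` and `θ`. (Modular characters of finite groups are trivial.) -/
def jacquet (ρ : Representation ℂ G V) (U : Subgroup G) (θ : U →* ℂ) :
    Representation ℂ (charStabilizer U θ) (JacquetSpace ρ U θ) :=
  Representation.quotient (ρ.comp (charStabilizer U θ).subtype) (twistedKer ρ U θ)
    (twistedKer_le_comap ρ U θ)

end General

variable {F : Type*} [Field F]

/-! ### Subgroups and representations of `SL₂(F)` -/

section SL2

/-- `SL₂(F)`. -/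
abbrev SL2 (F : Type*) [Field F] : Type _ := Matrix.SpecialLinearGroup (Fin 2) F

/-- `y ↦ diag(y, y⁻¹)`. -/
def torus : Fˣ →* SL2 F where
  toFun y := ⟨!![(y : F), 0; 0, ((y⁻¹ : Fˣ) : F)], by simp [Matrix.det_fin_two]⟩
  map_one' := by
    ext i j; fin_cases i <;> fin_cases j <;> simp
  map_mul' x y := by
    apply Subtype.ext
    change !![((x * y : Fˣ) : F), 0; 0, (((x * y)⁻¹ : Fˣ) : F)] =
      !![(x : F), 0; 0, ((x⁻¹ : Fˣ) : F)] * !![(y : F), 0; 0, ((y⁻¹ : Fˣ) : F)]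
    ext i j; fin_cases i <;> fin_cases j <;> simp [Matrix.mul_apply, Fin.sum_univ_two, mul_comm]

theorem coe_torus (y : Fˣ) : ((torus y : SL2 F) : Matrix (Fin 2) (Fin 2) F) =
    !![(y : F), 0; 0, ((y⁻¹ : Fˣ) : F)] := rfl

/-- `N_{1,1}`: the upper triangular unipotent subgroup. -/
def N11 (F : Type*) [Field F] : Subgroup (SL2 F) where
  carrier := {g | ∃ x : F, (g : Matrix (Fin 2) (Fin 2) F) = !![1, x; 0, 1]}
  one_mem' := ⟨0, by ext i j; fin_cases i <;> fin_cases j <;> simp⟩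
  mul_mem' := by
    rintro a b ⟨x, hx⟩ ⟨y, hy⟩
    refine ⟨x + y, ?_⟩
    rw [Matrix.SpecialLinearGroup.coe_mul, hx, hy]
    ext i j; fin_cases i <;> fin_cases j <;> simp [Matrix.mul_apply, Fin.sum_univ_two, add_comm]
  inv_mem' := by
    rintro a ⟨x, hx⟩
    refine ⟨-x, ?_⟩
    rw [Matrix.SpecialLinearGroup.coe_inv, hx, Matrix.adjugate_fin_two]
    ext i j; fin_cases i <;> fin_cases j <;> simp

theorem N11_apply (n : N11 F) :
    ((n : SL2 F) : Matrix (Fin 2) (Fin 2) F) =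
      !![1, ((n : SL2 F) : Matrix (Fin 2) (Fin 2) F) 0 1; 0, 1] := by
  obtain ⟨n, x, hx⟩ := n
  simp [hx]

/-- The character `ψ_c` of `N_{1,1}`: the unipotent matrix with entry `x` goes to `ψ₀(c x)`. -/
def psiN11 (ψ₀ : AddChar F ℂ) (c : F) : N11 F →* ℂ where
  toFun n := ψ₀ (c * ((n : SL2 F) : Matrix (Fin 2) (Fin 2) F) 0 1)
  map_one' := by simp
  map_mul' m n := by
    rw [← AddChar.map_add_eq_mul, ← mul_add]
    congr 2
    rw [Subgroup.coe_mul, Matrix.SpecialLinearGroup.coe_mul, N11_apply m, N11_apply n]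
    simp [Matrix.mul_apply, Fin.sum_univ_two, add_comm]

theorem torus_conj_mem (y : Fˣ) (n : SL2 F) (hn : n ∈ N11 F) :
    torus y * n * (torus y)⁻¹ ∈ N11 F := by
  obtain ⟨x, hx⟩ := hn
  refine ⟨y * x * y, ?_⟩
  rw [← map_inv]
  simp only [Matrix.SpecialLinearGroup.coe_mul, hx, coe_torus]
  ext i j; fin_cases i <;> fin_cases j <;> simp [Matrix.mul_apply, Fin.sum_univ_two]

theorem torus_mem_charStabilizer (y : Fˣ) :
    torus y ∈ charStabilizer (N11 F) (1 : N11 F →* ℂ) := by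
  refine ⟨fun u => ⟨torus_conj_mem y u, fun h => ?_⟩, fun _ _ _ => rfl⟩
  have := torus_conj_mem y⁻¹ _ h
  simpa [mul_assoc] using this

/-- The Jacquet module `r_{N_{1,1}}(τ)` as a representation of
`F^× ≅ M_{1,1} = {diag(y, y⁻¹)}`. -/
def jacquetN11 {V : Type*} [AddCommGroup V] [Module ℂ V] (τ : Representation ℂ (SL2 F) V) :
    Representation ℂ Fˣ (JacquetSpace τ (N11 F) 1) :=
  (jacquet τ (N11 F) 1).comp (torus.codRestrict _ torus_mem_charStabilizer)

/-- `τ` is cuspidal if its Jacquet module `r_{N_{1,1}}(τ)` is zero. -/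
def IsCuspidal {V : Type*} [AddCommGroup V] [Module ℂ V] (τ : Representation ℂ (SL2 F) V) : Prop :=
  Subsingleton (JacquetSpace τ (N11 F) 1)

/-- `Ψ'` lies in the orbit of `Ψ` under the conjugation action
`(m · Ψ)(n) = Ψ(m⁻¹ n m)` of `M_{1,1}` on the characters of `N_{1,1}`. -/
def InTorusOrbit (Ψ Ψ' : N11 F →* ℂ) : Prop :=
  ∃ y : Fˣ, ∀ n n' : N11 F, (n' : SL2 F) = (torus y)⁻¹ * n * torus y → Ψ' n = Ψ n'

/-- The Borel subgroup of upper triangular matrices. -/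
def borel (F : Type*) [Field F] : Subgroup (SL2 F) where
  carrier := {g | (g : Matrix (Fin 2) (Fin 2) F) 1 0 = 0}
  one_mem' := by simp
  mul_mem' := by
    intro a b ha hb
    simp only [Set.mem_ofPred_eq] at ha hb ⊢
    simp [Matrix.mul_apply, Fin.sum_univ_two, ha, hb]
  inv_mem' := by
    intro a ha
    simp only [Set.mem_ofPred_eq] at ha ⊢
    simp [Matrix.SpecialLinearGroup.coe_inv, Matrix.adjugate_fin_two, ha]

/-- The quotient map from the Borel subgroup to `M_{1,1} ≅ F^×`: the upper left entry. -/
def borelToTorus : borel F →* Fˣ where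
  toFun b := Units.mk0 (((b : SL2 F) : Matrix (Fin 2) (Fin 2) F) 0 0) (by
    intro h
    have h1 := (b : SL2 F).det_coe
    have h2 : ((b : SL2 F) : Matrix (Fin 2) (Fin 2) F) 1 0 = 0 := b.2
    rw [Matrix.det_fin_two, h, h2] at h1
    simp at h1)
  map_one' := by ext; simp
  map_mul' a b := by
    have h2 : ((b : SL2 F) : Matrix (Fin 2) (Fin 2) F) 1 0 = 0 := b.2
    ext; simp [Matrix.mul_apply, Fin.sum_univ_two, h2]

/-- The principal series representation `Ind_B^{SL₂(F)}(χ)`. -/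
abbrev principalSeries (χ : Fˣ →* ℂˣ) :
    Representation ℂ (SL2 F)
      (Representation.coindV (borel F).subtype (charRep (χ.comp borelToTorus))) :=
  induced (borel F) (charRep (χ.comp borelToTorus))

/-- `τ` is (isomorphic to) a principal series representation. -/
def IsPrincipalSeries {V : Type*} [AddCommGroup V] [Module ℂ V]
    (τ : Representation ℂ (SL2 F) V) : Prop :=
  ∃ χ : Fˣ →* ℂˣ, Nonempty (τ.Equiv (principalSeries χ))

/-- The irreducible representation `τ` is the special representation: the non-trivial component of
`Ind_B^{SL₂(F)}(1)`. -/
def IsSteinberg {V : Type*} [AddCommGroup V] [Module ℂ V]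
    (τ : Representation ℂ (SL2 F) V) : Prop :=
  ¬ τ.IsTrivial ∧ IsConstituent τ (principalSeries (1 : Fˣ →* ℂˣ))

end SL2

/-! ### Parabolic subgroups of `Sp₄(F)` -/

section Sp4

/-- `Sp₄(F)`, with basis `e₁, e₂, e₁^∨, e₂^∨` indexed by `inl 0, inl 1, inr 0, inr 1`. -/
abbrev Sp4 (F : Type*) [Field F] : Type _ := Matrix.symplecticGroup (Fin 2) F

/-- The basis vector `e₁`. -/
def e1 (F : Type*) [Field F] : Fin 2 ⊕ Fin 2 → F := Pi.single (Sum.inl 0) 1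

/-- The Klingen parabolic subgroup `Q`: the stabilizer of the line spanned by `e₁`. -/
def klingen (F : Type*) [Field F] : Subgroup (Sp4 F) where
  carrier := {g | ∃ t : Fˣ, (g : Matrix (Fin 2 ⊕ Fin 2) (Fin 2 ⊕ Fin 2) F) *ᵥ e1 F = (t : F) • e1 F}
  one_mem' := ⟨1, by simp⟩
  mul_mem' := by
    rintro a b ⟨s, hs⟩ ⟨t, ht⟩
    refine ⟨s * t, ?_⟩
    rw [Submonoid.coe_mul, ← Matrix.mulVec_mulVec, ht, Matrix.mulVec_smul, hs, smul_smul]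
    simp [mul_comm]
  inv_mem' := by
    rintro a ⟨t, ht⟩
    refine ⟨t⁻¹, ?_⟩
    have h1 : ((a⁻¹ : Sp4 F) : Matrix (Fin 2 ⊕ Fin 2) (Fin 2 ⊕ Fin 2) F) *
        (a : Matrix (Fin 2 ⊕ Fin 2) (Fin 2 ⊕ Fin 2) F) = 1 := by
      rw [← Submonoid.coe_mul, inv_mul_cancel, Submonoid.coe_one]
    have h2 := congrArg
      (fun v => ((a⁻¹ : Sp4 F) : Matrix (Fin 2 ⊕ Fin 2) (Fin 2 ⊕ Fin 2) F) *ᵥ v) ht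
    simp only [Matrix.mulVec_mulVec, h1, Matrix.one_mulVec, Matrix.mulVec_smul] at h2
    nth_rewrite 2 [h2]
    rw [smul_smul]
    simp

theorem klingen_col (q : klingen F) (i : Fin 2 ⊕ Fin 2) (hi : i ≠ Sum.inl 0) :
    ((q : Sp4 F) : Matrix (Fin 2 ⊕ Fin 2) (Fin 2 ⊕ Fin 2) F) i (Sum.inl 0) = 0 := by
  obtain ⟨q, t, ht⟩ := q
  have := congrFun ht i
  simpa [e1, Matrix.mulVec_single, hi] using this

theorem klingen_ne_zero (q : klingen F) :
    ((q : Sp4 F) : Matrix (Fin 2 ⊕ Fin 2) (Fin 2 ⊕ Fin 2) F) (Sum.inl 0) (Sum.inl 0) ≠ 0 := by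
  obtain ⟨q, t, ht⟩ := q
  have := congrFun ht (Sum.inl 0)
  simp [e1, Matrix.mulVec_single] at this
  simp [this]

theorem symplectic_entry (g : Sp4 F) (i j : Fin 2 ⊕ Fin 2) :
    let A : Matrix (Fin 2 ⊕ Fin 2) (Fin 2 ⊕ Fin 2) F := g
    A (Sum.inr 0) i * A (Sum.inl 0) j + A (Sum.inr 1) i * A (Sum.inl 1) j
      - A (Sum.inl 0) i * A (Sum.inr 0) j - A (Sum.inl 1) i * A (Sum.inr 1) j
      = Matrix.J (Fin 2) F i j := by
  intro A
  have h := congrFun (congrFun (SymplecticGroup.mem_iff'.1 g.2) i) j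
  rw [← h]
  simp [Matrix.mul_apply, Matrix.J, Fintype.sum_sum_type, Fin.sum_univ_two, A, Matrix.one_apply]
  ring

theorem klingen_row (q : klingen F) (j : Fin 2 ⊕ Fin 2) (hj : j ≠ Sum.inr 0) :
    ((q : Sp4 F) : Matrix (Fin 2 ⊕ Fin 2) (Fin 2 ⊕ Fin 2) F) (Sum.inr 0) j = 0 := by
  have h := symplectic_entry (q : Sp4 F) (Sum.inl 0) j
  simp only [klingen_col q (Sum.inr 0) (by simp), klingen_col q (Sum.inr 1) (by simp),
    klingen_col q (Sum.inl 1) (by simp)] at h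
  have hJ : Matrix.J (Fin 2) F (Sum.inl 0) j = 0 := by
    rcases j with j | j
    · simp [Matrix.J]
    · have : (0 : Fin 2) ≠ j := fun h => hj (by rw [h])
      simp [Matrix.J, this]
  rw [hJ] at h
  simpa [klingen_ne_zero q] using h

/-- The first component `Q → F^×`, `q ↦ t`, of the quotient map from `Q` to its Levi subgroup
`L ≅ F^× × SL₂(F)`. -/
def klingenGL1 : klingen F →* Fˣ where
  toFun q := Units.mk0 _ (klingen_ne_zero q)
  map_one' := by ext; simp
  map_mul' a b := by
    ext
    simp [Matrix.mul_apply, Fintype.sum_sum_type, Fin.sum_univ_two,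
      klingen_col b (Sum.inl 1) (by simp), klingen_col b (Sum.inr 0) (by simp),
      klingen_col b (Sum.inr 1) (by simp)]

/-- The block of a matrix in the rows and columns of `e₂, e₂^∨`. -/
def middleBlock (A : Matrix (Fin 2 ⊕ Fin 2) (Fin 2 ⊕ Fin 2) F) : Matrix (Fin 2) (Fin 2) F :=
  !![A (Sum.inl 1) (Sum.inl 1), A (Sum.inl 1) (Sum.inr 1);
    A (Sum.inr 1) (Sum.inl 1), A (Sum.inr 1) (Sum.inr 1)]

/-- The second component `Q → SL₂(F)` of the quotient map from `Q` to its Levi subgroup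
`L ≅ F^× × SL₂(F)`: the block of `q` in the rows and columns of `e₂, e₂^∨`. -/
def klingenSL2 : klingen F →* SL2 F where
  toFun q := ⟨middleBlock ((q : Sp4 F) : Matrix (Fin 2 ⊕ Fin 2) (Fin 2 ⊕ Fin 2) F), by
    have h := symplectic_entry (q : Sp4 F) (Sum.inl 1) (Sum.inr 1)
    simp only [klingen_row q (Sum.inl 1) (by simp), klingen_row q (Sum.inr 1) (by simp)] at h
    simp [Matrix.J] at h
    simp [middleBlock, Matrix.det_fin_two]
    linear_combination -h⟩
  map_one' := by
    ext i j; fin_cases i <;> fin_cases j <;> simp [middleBlock]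
  map_mul' a b := by
    apply Subtype.ext
    change middleBlock (((a * b : klingen F) : Sp4 F) : Matrix (Fin 2 ⊕ Fin 2) (Fin 2 ⊕ Fin 2) F) =
      middleBlock ((a : Sp4 F) : Matrix _ _ F) * middleBlock ((b : Sp4 F) : Matrix _ _ F)
    ext i j
    fin_cases i <;> fin_cases j <;>
    simp [middleBlock, Matrix.mul_apply, Fintype.sum_sum_type, Fin.sum_univ_two,
      klingen_col a (Sum.inl 1) (by simp), klingen_col a (Sum.inr 1) (by simp),
      klingen_row b (Sum.inl 1) (by simp), klingen_row b (Sum.inr 1) (by simp)]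

/-- The representation `η ⊗ τ` of `L ≅ F^× × SL₂(F)`, extended to `Q` trivially on the unipotent
radical. -/
def klingenInflation {V : Type*} [AddCommGroup V] [Module ℂ V] (η : Fˣ →* ℂˣ)
    (τ : Representation ℂ (SL2 F) V) : Representation ℂ (klingen F) V :=
  charTwist (η.comp klingenGL1) (τ.comp klingenSL2)

/-- The representation `Π = Ind_Q^{Sp₄(F)}(η ⊗ τ)`. -/
abbrev klingenInd {V : Type*} [AddCommGroup V] [Module ℂ V] (η : Fˣ →* ℂˣ)
    (τ : Representation ℂ (SL2 F) V) :
    Representation ℂ (Sp4 F) (Representation.coindV (klingen F).subtype (klingenInflation η τ)) :=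
  induced (klingen F) (klingenInflation η τ)

/-- The unipotent radical `N` of the Siegel parabolic subgroup. -/
def siegelN (F : Type*) [Field F] : Subgroup (Sp4 F) where
  carrier := {g | ∃ X : Matrix (Fin 2) (Fin 2) F, X.IsSymm ∧
    (g : Matrix (Fin 2 ⊕ Fin 2) (Fin 2 ⊕ Fin 2) F) = Matrix.fromBlocks 1 X 0 1}
  one_mem' := ⟨0, Matrix.isSymm_zero, by simp⟩
  mul_mem' := by
    rintro a b ⟨X, hX, ha⟩ ⟨Y, hY, hb⟩
    refine ⟨X + Y, hX.add hY, ?_⟩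
    rw [Submonoid.coe_mul, ha, hb, Matrix.fromBlocks_multiply]
    simp [add_comm]
  inv_mem' := by
    rintro a ⟨X, hX, ha⟩
    refine ⟨-X, hX.neg, ?_⟩
    rw [SymplecticGroup.coe_inv, ha]
    simp [Matrix.J, Matrix.fromBlocks_transpose, Matrix.fromBlocks_multiply,
      Matrix.fromBlocks_neg, hX.eq]

theorem siegelN_apply (n : siegelN F) :
    ((n : Sp4 F) : Matrix (Fin 2 ⊕ Fin 2) (Fin 2 ⊕ Fin 2) F) = Matrix.fromBlocks 1
      ((n : Sp4 F) : Matrix (Fin 2 ⊕ Fin 2) (Fin 2 ⊕ Fin 2) F).toBlocks₁₂ 0 1 := by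
  obtain ⟨n, X, hX, hn⟩ := n
  simp [hn]

/-- The matrix `C = diag(γ, 0)`. -/
def matC (γ : Fˣ) : Matrix (Fin 2) (Fin 2) F := !![(γ : F), 0; 0, 0]

/-- The character `ψ_C` of `N`: the unipotent matrix with upper right block `X` goes to
`ψ₀(tr(C X))`. -/
def psiC (ψ₀ : AddChar F ℂ) (γ : Fˣ) : siegelN F →* ℂ where
  toFun n := ψ₀ (matC γ *
    ((n : Sp4 F) : Matrix (Fin 2 ⊕ Fin 2) (Fin 2 ⊕ Fin 2) F).toBlocks₁₂).trace
  map_one' := by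
    have : (1 : Matrix (Fin 2 ⊕ Fin 2) (Fin 2 ⊕ Fin 2) F).toBlocks₁₂ = 0 := by
      rw [← Matrix.fromBlocks_one, Matrix.toBlocks_fromBlocks₁₂]
    simp [this]
  map_mul' m n := by
    rw [← AddChar.map_add_eq_mul, ← Matrix.trace_add, ← mul_add]
    congr 3
    rw [Subgroup.coe_mul, Submonoid.coe_mul, siegelN_apply m, siegelN_apply n,
      Matrix.fromBlocks_multiply]
    simp [add_comm]

/-- The embedding `g ↦ diag(g, ᵗg⁻¹)` of `GL₂(F)` onto the Siegel Levi subgroup `M`. -/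
def siegelLevi : GL (Fin 2) F →* Sp4 F where
  toFun g := ⟨Matrix.fromBlocks (g : Matrix (Fin 2) (Fin 2) F) 0 0
      ((g⁻¹ : GL (Fin 2) F) : Matrix (Fin 2) (Fin 2) F)ᵀ, by
    rw [SymplecticGroup.fromBlocks_mem_iff]
    refine ⟨by simp, by simp, ?_⟩
    rw [← Matrix.transpose_mul, ← Units.val_mul]
    simp⟩
  map_one' := by
    apply Subtype.ext
    simp
  map_mul' g h := by
    apply Subtype.ext
    simp [Matrix.fromBlocks_multiply]

end Sp4

/-! ### The group `O₂(F, C)` and its representations -/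

section O2

/-- The group `O₂(F, C)` preserving the symmetric bilinear form with matrix `C = diag(γ, 0)`. -/
def O2 (γ : Fˣ) : Subgroup (GL (Fin 2) F) where
  carrier := {g | (g : Matrix (Fin 2) (Fin 2) F)ᵀ * matC γ * (g : Matrix (Fin 2) (Fin 2) F)
    = matC γ}
  one_mem' := by simp
  mul_mem' := by
    intro a b ha hb
    simp only [Set.mem_ofPred_eq] at ha hb ⊢
    rw [Units.val_mul, Matrix.transpose_mul]
    calc _ = (b : Matrix (Fin 2) (Fin 2) F)ᵀ * ((a : Matrix (Fin 2) (Fin 2) F)ᵀ * matC γ *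
          (a : Matrix (Fin 2) (Fin 2) F)) * (b : Matrix (Fin 2) (Fin 2) F) := by
            simp only [mul_assoc]
      _ = _ := by rw [ha, hb]
  inv_mem' := by
    intro a ha
    simp only [Set.mem_ofPred_eq] at ha ⊢
    have h1 : (a : Matrix (Fin 2) (Fin 2) F) * ((a⁻¹ : GL (Fin 2) F) : Matrix (Fin 2) (Fin 2) F)
        = 1 := by rw [← Units.val_mul]; simp
    have h2 : ((a⁻¹ : GL (Fin 2) F) : Matrix (Fin 2) (Fin 2) F)ᵀ *
        (a : Matrix (Fin 2) (Fin 2) F)ᵀ = 1 := by rw [← Matrix.transpose_mul, h1]; simp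
    calc _ = ((a⁻¹ : GL (Fin 2) F) : Matrix (Fin 2) (Fin 2) F)ᵀ *
          ((a : Matrix (Fin 2) (Fin 2) F)ᵀ * matC γ * (a : Matrix (Fin 2) (Fin 2) F)) *
          ((a⁻¹ : GL (Fin 2) F) : Matrix (Fin 2) (Fin 2) F) := by rw [ha]
      _ = (((a⁻¹ : GL (Fin 2) F) : Matrix (Fin 2) (Fin 2) F)ᵀ *
          (a : Matrix (Fin 2) (Fin 2) F)ᵀ) * matC γ * ((a : Matrix (Fin 2) (Fin 2) F) *
          ((a⁻¹ : GL (Fin 2) F) : Matrix (Fin 2) (Fin 2) F)) := by simp only [mul_assoc]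
      _ = _ := by rw [h1, h2]; simp

/-- `O₂(F, C)` consists of the invertible matrices with rows `(±1, 0)` and `(y, d)`. -/
theorem mem_O2_iff (γ : Fˣ) (g : GL (Fin 2) F) :
    g ∈ O2 γ ↔ (g : Matrix (Fin 2) (Fin 2) F) 0 0 * (g : Matrix (Fin 2) (Fin 2) F) 0 0 = 1 ∧
      (g : Matrix (Fin 2) (Fin 2) F) 0 1 = 0 := by
  have hγ : (γ : F) ≠ 0 := γ.ne_zero
  have key : g ∈ O2 γ ↔
      (g : Matrix (Fin 2) (Fin 2) F)ᵀ * matC γ * (g : Matrix (Fin 2) (Fin 2) F) = matC γ := Iff.rfl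
  rw [key]
  constructor
  · intro h
    have h00 := congrFun (congrFun h 0) 0
    have h11 := congrFun (congrFun h 1) 1
    simp [matC, Matrix.mul_apply, Fin.sum_univ_two] at h00 h11
    refine ⟨?_, h11⟩
    apply mul_left_cancel₀ hγ
    linear_combination h00
  · rintro ⟨h1, h2⟩
    ext i j
    fin_cases i <;> fin_cases j <;> simp [matC, Matrix.mul_apply, Fin.sum_univ_two, h2]
    linear_combination (γ : F) * h1

/-- The diagonal entry `a = ±1` of an element of `O₂(F, C)`. -/
def o2a (γ : Fˣ) : O2 γ →* Fˣ where
  toFun g := ⟨((g : GL (Fin 2) F) : Matrix (Fin 2) (Fin 2) F) 0 0,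
    ((g : GL (Fin 2) F) : Matrix (Fin 2) (Fin 2) F) 0 0,
    ((mem_O2_iff γ g).1 g.2).1, ((mem_O2_iff γ g).1 g.2).1⟩
  map_one' := by ext; simp
  map_mul' g h := by
    ext
    simp [Matrix.mul_apply, Fin.sum_univ_two, ((mem_O2_iff γ g).1 g.2).2]

/-- The diagonal entry `d` of an element of `O₂(F, C)`. -/
def o2d (γ : Fˣ) : O2 γ →* Fˣ where
  toFun g := Units.mk0 (((g : GL (Fin 2) F) : Matrix (Fin 2) (Fin 2) F) 1 1) (by
    intro h
    have h1 := (Matrix.isUnits_det_units (g : GL (Fin 2) F)).ne_zero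
    rw [Matrix.det_fin_two, h, ((mem_O2_iff γ g).1 g.2).2] at h1
    simp at h1)
  map_one' := by ext; simp
  map_mul' g h := by
    ext
    simp [Matrix.mul_apply, Fin.sum_univ_two, ((mem_O2_iff γ h).1 h.2).2]

/-- The subgroup `T₂(F, C)` of diagonal matrices `diag(±1, d)` in `O₂(F, C)`. -/
def T2 (γ : Fˣ) : Subgroup (O2 γ) where
  carrier := {g | ((g : GL (Fin 2) F) : Matrix (Fin 2) (Fin 2) F) 1 0 = 0}
  one_mem' := by simp
  mul_mem' := by
    intro a b ha hb
    simp only [Set.mem_ofPred_eq] at ha hb ⊢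
    simp [Matrix.mul_apply, Fin.sum_univ_two, ha, hb]
  inv_mem' := by
    intro a ha
    simp only [Set.mem_ofPred_eq] at ha ⊢
    simp [Matrix.inv_def, Matrix.adjugate_fin_two, ha]

/-- The matrix `diag(a, d)` in `GL₂(F)`. -/
def diagGL (a d : Fˣ) : GL (Fin 2) F :=
  ⟨!![(a : F), 0; 0, (d : F)], !![((a⁻¹ : Fˣ) : F), 0; 0, ((d⁻¹ : Fˣ) : F)],
    by ext i j; fin_cases i <;> fin_cases j <;> simp [Matrix.mul_apply, Fin.sum_univ_two],
    by ext i j; fin_cases i <;> fin_cases j <;> simp [Matrix.mul_apply, Fin.sum_univ_two]⟩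

/-- The quotient map `O₂(F, C) → T₂(F, C)`, sending the matrix with rows `(a, 0)` and `(y, d)` to
`diag(a, d)`. -/
def o2ToT2 (γ : Fˣ) : O2 γ →* T2 γ where
  toFun g := ⟨⟨diagGL (o2a γ g) (o2d γ g), (mem_O2_iff γ _).2
    ⟨by simpa [diagGL, o2a] using ((mem_O2_iff γ g).1 g.2).1, by simp [diagGL]⟩⟩, by
      change ((diagGL _ _ : GL (Fin 2) F) : Matrix (Fin 2) (Fin 2) F) 1 0 = 0
      simp [diagGL]⟩
  map_one' := by
    apply Subtype.ext; apply Subtype.ext; apply Units.ext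
    ext i j; fin_cases i <;> fin_cases j <;> simp [diagGL]
  map_mul' g h := by
    apply Subtype.ext; apply Subtype.ext; apply Units.ext
    ext i j
    fin_cases i <;> fin_cases j <;> simp [diagGL, Matrix.mul_apply, Fin.sum_univ_two]

theorem torus_o2a_mem_center (γ : Fˣ) (t : T2 γ) :
    torus (o2a γ (t : O2 γ)) ∈ Subgroup.center (SL2 F) := by
  have h : ((o2a γ (t : O2 γ))⁻¹ : Fˣ) = o2a γ (t : O2 γ) := rfl
  rw [Subgroup.mem_center_iff]
  intro g
  apply Subtype.ext
  rw [Matrix.SpecialLinearGroup.coe_mul, Matrix.SpecialLinearGroup.coe_mul, coe_torus, h]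
  ext i j
  fin_cases i <;> fin_cases j <;>
    simp [Matrix.mul_apply, Fin.sum_univ_two, mul_comm]

/-- The map `T₂(F, C) → {±1} = Z(SL₂(F))`, `diag(a, d) ↦ a I₂`. -/
def t2ToCenter (γ : Fˣ) : T2 γ →* Subgroup.center (SL2 F) :=
  (torus.comp ((o2a γ).comp (T2 γ).subtype)).codRestrict _ (torus_o2a_mem_center γ)

/-- The character `ω ⊗ η`, `diag(a, d) ↦ ω(a I₂) η(d)`, of `T₂(F, C) ≅ {±1} × F^×`. -/
def t2Char (γ : Fˣ) (ω : Subgroup.center (SL2 F) →* ℂˣ) (η : Fˣ →* ℂˣ) : T2 γ →* ℂˣ :=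
  ω.comp (t2ToCenter γ) * η.comp ((o2d γ).comp (T2 γ).subtype)

variable {V : Type*} [AddCommGroup V] [Module ℂ V]

/-- `ϱ₀`: the inflation to `O₂(F, C)` of the representation `ω_τ ⊗ η` of `T₂(F, C)`. -/
def rho0 (γ : Fˣ) (η : Fˣ →* ℂˣ) (τ : Representation ℂ (SL2 F) V) :
    Representation ℂ (O2 γ) ℂ :=
  (charRep (t2Char γ (centralCharacter τ) η)).comp (o2ToT2 γ)

/-- The representation `η|_{±1} ⊗ r_{N_{1,1}}(τ)` of `T₂(F, C)`:
`diag(a, d) ↦ η(a) r_{N_{1,1}}(τ)(diag(d, d⁻¹))`. -/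
def rho1T (γ : Fˣ) (η : Fˣ →* ℂˣ) (τ : Representation ℂ (SL2 F) V) :
    Representation ℂ (T2 γ) (JacquetSpace τ (N11 F) 1) :=
  charTwist (η.comp ((o2a γ).comp (T2 γ).subtype))
    ((jacquetN11 τ).comp ((o2d γ).comp (T2 γ).subtype))

/-- `ϱ₁`: the inflation to `O₂(F, C)` of the representation `η|_{±1} ⊗ r_{N_{1,1}}(τ)` of
`T₂(F, C)`. -/
def rho1 (γ : Fˣ) (η : Fˣ →* ℂˣ) (τ : Representation ℂ (SL2 F) V) :
    Representation ℂ (O2 γ) (JacquetSpace τ (N11 F) 1) :=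
  (rho1T γ η τ).comp (o2ToT2 γ)

/-- `ϱ₂`: the representation `ω_τ ⊗ η⁻¹` of `T₂(F, C)`. -/
def rho2 (γ : Fˣ) (η : Fˣ →* ℂˣ) (τ : Representation ℂ (SL2 F) V) :
    Representation ℂ (T2 γ) ℂ :=
  charRep (t2Char γ (centralCharacter τ) η⁻¹)

/-- `μ₁ = ϱ₀ ⊕ ϱ₁ ⊕ Ind_{T₂}^{O₂}(ϱ₂)`. -/
abbrev mu1 (γ : Fˣ) (η : Fˣ →* ℂˣ) (τ : Representation ℂ (SL2 F) V) :=
  (rho0 γ η τ).prod ((rho1 γ η τ).prod (induced (T2 γ) (rho2 γ η τ)))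

/-- `μ₂ = ϱ₀ ⊕ Ind_{T₂}^{O₂}(ϱ₂)`. -/
abbrev mu2 (γ : Fˣ) (η : Fˣ →* ℂˣ) (τ : Representation ℂ (SL2 F) V) :=
  (rho0 γ η τ).prod (induced (T2 γ) (rho2 γ η τ))

theorem siegelLevi_conj (g : GL (Fin 2) F) (n : siegelN F) :
    ((siegelLevi g * n * (siegelLevi g)⁻¹ : Sp4 F) :
      Matrix (Fin 2 ⊕ Fin 2) (Fin 2 ⊕ Fin 2) F) =
      Matrix.fromBlocks 1 ((g : Matrix (Fin 2) (Fin 2) F) *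
        ((n : Sp4 F) : Matrix (Fin 2 ⊕ Fin 2) (Fin 2 ⊕ Fin 2) F).toBlocks₁₂ *
        (g : Matrix (Fin 2) (Fin 2) F)ᵀ) 0 1 := by
  have h1 : (g : Matrix (Fin 2) (Fin 2) F) * ((g⁻¹ : GL (Fin 2) F) : Matrix (Fin 2) (Fin 2) F)
      = 1 := by rw [← Units.val_mul]; simp
  have h2 : ((g⁻¹ : GL (Fin 2) F) : Matrix (Fin 2) (Fin 2) F)ᵀ *
      (g : Matrix (Fin 2) (Fin 2) F)ᵀ = 1 := by rw [← Matrix.transpose_mul, h1]; simp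
  rw [← map_inv, Submonoid.coe_mul, Submonoid.coe_mul, siegelN_apply n]
  change Matrix.fromBlocks _ _ _ _ * _ * Matrix.fromBlocks _ _ _ _ = _
  rw [Matrix.fromBlocks_multiply, Matrix.fromBlocks_multiply]
  simp only [inv_inv, Matrix.mul_zero, Matrix.zero_mul, add_zero, zero_add, Matrix.mul_one, h1, h2,
    Matrix.toBlocks_fromBlocks₁₂]

theorem siegelLevi_conj_mem (g : GL (Fin 2) F) (n : Sp4 F) (hn : n ∈ siegelN F) :
    siegelLevi g * n * (siegelLevi g)⁻¹ ∈ siegelN F := by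
  refine ⟨_, ?_, siegelLevi_conj g ⟨n, hn⟩⟩
  obtain ⟨X, hX, hn⟩ := hn
  simp [Matrix.IsSymm, hn, Matrix.transpose_mul, hX.eq, mul_assoc]

theorem siegelLevi_mem_charStabilizer (ψ₀ : AddChar F ℂ) (γ : Fˣ) (g : O2 γ) :
    siegelLevi (g : GL (Fin 2) F) ∈ charStabilizer (siegelN F) (psiC ψ₀ γ) := by
  refine ⟨fun u => ⟨siegelLevi_conj_mem _ u, fun h => ?_⟩, fun u u' h => ?_⟩
  · have := siegelLevi_conj_mem (g : GL (Fin 2) F)⁻¹ _ h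
    simpa [mul_assoc] using this
  · have hg : ((g : GL (Fin 2) F) : Matrix (Fin 2) (Fin 2) F)ᵀ * matC γ *
      ((g : GL (Fin 2) F) : Matrix (Fin 2) (Fin 2) F) = matC γ := g.2
    change ψ₀ _ = ψ₀ _
    congr 1
    rw [h, siegelLevi_conj, Matrix.toBlocks_fromBlocks₁₂]
    conv_rhs => rw [← hg]
    rw [← mul_assoc, Matrix.trace_mul_comm]
    simp only [mul_assoc]

/-- The embedding of `O₂(F, C)` in `Sp₄(F)` by `g ↦ diag(g, ᵗg⁻¹)`; it identifies `O₂(F, C)`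
with the stabilizer `M_ψ` of `ψ_C` in the Siegel Levi subgroup. -/
def o2Embed (ψ₀ : AddChar F ℂ) (γ : Fˣ) :
    O2 γ →* charStabilizer (siegelN F) (psiC ψ₀ γ) :=
  (siegelLevi.comp (O2 γ).subtype).codRestrict _ (siegelLevi_mem_charStabilizer ψ₀ γ)

/-- The twisted Jacquet module `r_{N,ψ_C}(π)` as a representation of `O₂(F, C)`. -/
def jacquetC (ψ₀ : AddChar F ℂ) (γ : Fˣ) (π : Representation ℂ (Sp4 F) V) :
    Representation ℂ (O2 γ) (JacquetSpace π (siegelN F) (psiC ψ₀ γ)) :=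
  (jacquet π (siegelN F) (psiC ψ₀ γ)).comp (o2Embed ψ₀ γ)

end O2

end KlingenJacquet

end

/-!
Averaging against `ψ_C` identifies `r_{N,ψ}(Π)` with the `(N, ψ_C)`-equivariant functions in `Π`.
A coset in `Q \ Sp₄` is the line spanned by the third row `(x, y)` of a matrix, and `N` acts on rows
by `(x, y) ↦ (x, y + xX)`, so every row can be moved to `(0, y)` or to `(x, 0)`. The
stabilizer in `N` of the line of `(0, y)` is `N` itself, and if `y₀ ≠ 0` a subgroup of it on which
`ψ_C` is non-trivial acts trivially on the fibre, so an equivariant function vanishes there. What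
is left up to `N` is the `O₂`-fixed line `(0, 0; 0, 1)`, where the value lies in the `ψ_γ`-Whittaker
quotient of `τ`, the `O₂`-fixed line `(1, 0; 0, 0)`, where it lies in `r_{N₁₁}(τ)`, and the
`O₂`-orbit of `(0, 1; 0, 0)`, on which the functions are induced from `T₂` with values again in the
Whittaker quotient. Hence for every `τ`

  `r_{N,ψ}(Π) ≅ W ⊕ ϱ₁ ⊕ Ind_{T₂}^{O₂} W'`,

where `W` and `W'` are the Whittaker quotient with `T₂` acting through the center of `SL₂` and
through `η`, respectively `η⁻¹`. For irreducible `τ` the Whittaker quotient is at most a line, by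
Gelfand's argument with the anti-involution of `SL₂` exchanging the diagonal entries, so the cases
of the theorem differ only in whether it vanishes and whether `r_{N₁₁}(τ)` does.
-/

noncomputable section

namespace KlingenJacquet

theorem charRep_apply {G : Type*} [Group G] (χ : G →* ℂˣ) (g : G) (z : ℂ) :
    charRep χ g z = (χ g : ℂ) * z := by
  simp [charRep, charTwist]

section TwistProj

variable {G : Type*} [Group G] {V W : Type*} [AddCommGroup V] [Module ℂ V] [AddCommGroup W]
  [Module ℂ W]

/-- The operator `∑ θ(u⁻¹) ρ(u)`, which is `|U|` times the projection of `ρ` onto its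
`(U, θ)`-isotypic subspace. -/
def twistProj (ρ : Representation ℂ G V) (U : Subgroup G) [Finite U] (θ : U →* ℂ) : V →ₗ[ℂ] V :=
  letI := Fintype.ofFinite U
  ∑ u : U, θ u⁻¹ • ρ (u : G)

variable (ρ : Representation ℂ G V) (U : Subgroup G) (θ : U →* ℂ)

theorem twistProj_apply [Fintype U] (v : V) :
    twistProj ρ U θ v = ∑ u : U, θ u⁻¹ • ρ (u : G) v := by
  simp only [twistProj, LinearMap.sum_apply, LinearMap.smul_apply]
  congr!

variable [Finite U]

theorem rep_twistProj (u : U) (v : V) :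
    ρ (u : G) (twistProj ρ U θ v) = θ u • twistProj ρ U θ v := by
  have := Fintype.ofFinite U
  rw [twistProj_apply, map_sum, Finset.smul_sum]
  refine Fintype.sum_equiv (Equiv.mulLeft u) _ _ fun x => ?_
  simp only [Equiv.coe_mulLeft, _root_.mul_inv_rev, map_mul, map_smul, smul_smul,
    Subgroup.coe_mul, Module.End.mul_apply]
  rw [mul_left_comm, map_mul_eq_one θ (mul_inv_cancel u), mul_one]

theorem twistProj_rep (u : U) (v : V) :
    twistProj ρ U θ (ρ (u : G) v) = θ u • twistProj ρ U θ v := by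
  have := Fintype.ofFinite U
  rw [twistProj_apply, twistProj_apply, Finset.smul_sum]
  refine Fintype.sum_equiv (Equiv.mulRight u) _ _ fun x => ?_
  simp only [Equiv.coe_mulRight, _root_.mul_inv_rev, map_mul, smul_smul, Subgroup.coe_mul,
    Module.End.mul_apply]
  rw [← mul_assoc, map_mul_eq_one θ (mul_inv_cancel u), one_mul]

theorem card_smul_sub_twistProj [Fintype U] (v : V) :
    (Nat.card U : ℂ) • v - twistProj ρ U θ v = -∑ u : U, θ u⁻¹ • (ρ (u : G) v - θ u • v) := by
  simp_rw [smul_sub, Finset.sum_sub_distrib, ← twistProj_apply, smul_smul,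
    map_mul_eq_one θ (inv_mul_cancel _), one_smul]
  simp [Nat.card_eq_fintype_card, Nat.cast_smul_eq_nsmul]

theorem twistProj_eq_card_smul {v : V} (hv : ∀ u : U, ρ (u : G) v = θ u • v) :
    twistProj ρ U θ v = (Nat.card U : ℂ) • v := by
  have := Fintype.ofFinite U
  have h := card_smul_sub_twistProj ρ U θ v
  simp only [hv, sub_self, smul_zero, Finset.sum_const_zero, neg_zero] at h
  exact (sub_eq_zero.1 h).symm

theorem ker_twistProj : LinearMap.ker (twistProj ρ U θ) = twistedKer ρ U θ := by
  apply le_antisymm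
  · intro v hv
    have := Fintype.ofFinite U
    have hcard : (Nat.card U : ℂ) ≠ 0 := by exact_mod_cast Nat.card_pos.ne'
    have h := card_smul_sub_twistProj ρ U θ v
    rw [LinearMap.mem_ker.1 hv, sub_zero] at h
    rw [← Submodule.smul_mem_iff _ hcard, h]
    exact Submodule.neg_mem _ (Submodule.sum_mem _ fun u _ =>
      Submodule.smul_mem _ _ (Submodule.subset_span ⟨u, v, rfl⟩))
  · refine Submodule.span_le.2 ?_
    rintro _ ⟨u, v, rfl⟩
    simp [twistProj_rep]

theorem subsingleton_jacquetSpace_iff :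
    Subsingleton (JacquetSpace ρ U θ) ↔ ∀ v, twistProj ρ U θ v = 0 := by
  rw [Submodule.Quotient.subsingleton_iff, ← ker_twistProj, LinearMap.ker_eq_top,
    LinearMap.ext_iff]
  rfl

theorem nontrivial_jacquetSpace_iff :
    Nontrivial (JacquetSpace ρ U θ) ↔ ∃ v, twistProj ρ U θ v ≠ 0 := by
  rw [← not_subsingleton_iff_nontrivial, subsingleton_jacquetSpace_iff, not_forall]

theorem finrank_jacquetSpace :
    Module.finrank ℂ (JacquetSpace ρ U θ) =
      Module.finrank ℂ (LinearMap.range (twistProj ρ U θ)) :=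
  ((Submodule.quotEquivOfEq _ _ (ker_twistProj ρ U θ).symm).trans
    (twistProj ρ U θ).quotKerEquivRange).finrank_eq

variable {ρ} in
theorem map_twistProj {σ : Representation ℂ G W} (f : ρ.IntertwiningMap σ) (v : V) :
    f (twistProj ρ U θ v) = twistProj σ U θ (f v) := by
  have := Fintype.ofFinite U
  simp_rw [twistProj_apply, map_sum, map_smul, f.isIntertwining]

theorem twistProj_rep_of_mem_charStabilizer {m : G} (hm : m ∈ charStabilizer U θ) (v : V) :
    twistProj ρ U θ (ρ m v) = ρ m (twistProj ρ U θ v) := by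
  have := Fintype.ofFinite U
  obtain ⟨hnorm, hθ⟩ := hm
  let conj : U ≃ U :=
    { toFun := fun u => ⟨m * u * m⁻¹, (hnorm u).1 u.2⟩
      invFun := fun u => ⟨m⁻¹ * u * m, (hnorm _).2 (by simp [mul_assoc])⟩
      left_inv := fun u => Subtype.ext (by simp [mul_assoc])
      right_inv := fun u => Subtype.ext (by simp [mul_assoc]) }
  rw [twistProj_apply, twistProj_apply, map_sum]
  refine (Fintype.sum_equiv conj _ _ fun u => ?_).symm
  have hu : θ (conj u)⁻¹ = θ u⁻¹ := hθ u⁻¹ (conj u)⁻¹ (by simp [conj, mul_assoc])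
  rw [hu, map_smul]
  simp [conj, ← Module.End.mul_apply, ← map_mul]

end TwistProj

section Irreducible

variable {G : Type*} [Group G] {V : Type*} [AddCommGroup V] [Module ℂ V]
  {ρ : Representation ℂ G V} [ρ.IsIrreducible]

theorem eq_top_of_rep_mem {p : Submodule ℂ V} (hp : ∀ g, ∀ x ∈ p, ρ g x ∈ p) {v : V}
    (hv : v ∈ p) (hv0 : v ≠ 0) : p = ⊤ := by
  let S : Subrepresentation ρ := ⟨p, fun g x hx => hp g x hx⟩
  rcases eq_bot_or_eq_top S with h | h
  · exact absurd (show v ∈ (⊥ : Subrepresentation ρ).toSubmodule from h ▸ hv) hv0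
  · exact congrArg Subrepresentation.toSubmodule h

theorem nontrivial_of_isIrreducible (ρ : Representation ℂ G V) [ρ.IsIrreducible] :
    Nontrivial V := by
  by_contra hV
  rw [not_nontrivial_iff_subsingleton] at hV
  refine bot_ne_top (α := Subrepresentation ρ) (Subrepresentation.toSubmodule_injective ?_)
  exact Subsingleton.elim _ _

theorem finiteDimensional_of_isIrreducible (ρ : Representation ℂ G V) [ρ.IsIrreducible]
    [Finite G] : FiniteDimensional ℂ V := by
  have := nontrivial_of_isIrreducible ρ
  obtain ⟨v, hv⟩ := exists_ne (0 : V)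
  let p := Submodule.span ℂ (Set.range fun g => ρ g v)
  have hp : ∀ g, p ≤ p.comap (ρ g) := fun g => Submodule.span_le.2 <| by
    rintro _ ⟨h, rfl⟩
    exact Submodule.subset_span ⟨g * h, by simp⟩
  have htop : p = ⊤ := eq_top_of_rep_mem hp (Submodule.subset_span ⟨1, by simp⟩) hv
  exact ⟨htop ▸ Submodule.fg_span (Set.finite_range _)⟩

theorem range_le_of_apply_rep_mem {e : V →ₗ[ℂ] V} {p : Submodule ℂ V} {w : V} (hw : w ≠ 0)
    (h : ∀ g, e (ρ g w) ∈ p) : LinearMap.range e ≤ p := by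
  let q : Submodule ℂ V := ⨅ g, p.comap (e ∘ₗ ρ g)
  have hq : ∀ x, x ∈ q ↔ ∀ g, e (ρ g x) ∈ p := fun x => by simp [q]
  have htop : q = ⊤ := by
    refine eq_top_of_rep_mem (ρ := ρ) (fun g x hx => (hq _).2 fun g' => ?_) ((hq w).2 h) hw
    simpa using (hq x).1 hx (g' * g)
  rintro _ ⟨x, rfl⟩
  simpa using (hq x).1 (htop ▸ Submodule.mem_top) 1

theorem exists_smul_of_commute [Finite G] {e : V →ₗ[ℂ] V}
    (hcomm : ∀ g h v, e (ρ g (e (ρ h (e v)))) = e (ρ h (e (ρ g (e v))))) (he : e ≠ 0) (g : G) :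
    ∃ c : ℂ, ∀ v, e (ρ g (e v)) = c • e v := by
  have := finiteDimensional_of_isIrreducible ρ
  have : Nontrivial (LinearMap.range e) :=
    (Submodule.nontrivial_iff_ne_bot).2 (mt LinearMap.range_eq_bot.1 he)
  let T : LinearMap.range e →ₗ[ℂ] LinearMap.range e := (e ∘ₗ ρ g).restrict fun w _ => ⟨_, rfl⟩
  obtain ⟨c, hc⟩ := Module.End.exists_eigenvalue T
  obtain ⟨⟨_, w, rfl⟩, hw⟩ := hc.exists_hasEigenvector
  have hTw : e (ρ g (e w)) = c • e w := congrArg Subtype.val hw.apply_eq_smul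
  let eigenspace : Submodule ℂ V := LinearMap.ker (e ∘ₗ ρ g - c • LinearMap.id)
  have hmem : ∀ x, x ∈ eigenspace ↔ e (ρ g x) = c • x := fun x => by
    simp [eigenspace, sub_eq_zero]
  have hle : LinearMap.range e ≤ eigenspace :=
    range_le_of_apply_rep_mem (ρ := ρ) (w := e w) (fun h => hw.2 (Subtype.ext h)) fun h => by
      rw [hmem, hcomm, hTw, map_smul, map_smul]
  exact ⟨c, fun v => (hmem _).1 (hle ⟨v, rfl⟩)⟩

theorem finrank_range_le_one_of_commute [Finite G] {e : V →ₗ[ℂ] V}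
    (hcomm : ∀ g h v, e (ρ g (e (ρ h (e v)))) = e (ρ h (e (ρ g (e v))))) :
    Module.finrank ℂ (LinearMap.range e) ≤ 1 := by
  have := finiteDimensional_of_isIrreducible ρ
  rcases eq_or_ne e 0 with rfl | he
  · rw [LinearMap.range_zero, finrank_bot]
    exact zero_le_one
  obtain ⟨w, hw⟩ : ∃ w, e w ≠ 0 := by
    by_contra! h
    exact he (LinearMap.ext h)
  have hle : LinearMap.range e ≤ Submodule.span ℂ {e w} :=
    range_le_of_apply_rep_mem (ρ := ρ) hw fun g => by
      obtain ⟨c, hc⟩ := exists_smul_of_commute hcomm he g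
      exact hc w ▸ Submodule.smul_mem _ c (Submodule.mem_span_singleton_self _)
  exact (Submodule.finrank_mono hle).trans (finrank_span_le_card _ |>.trans (by simp))

theorem eq_zero_of_mem_invariants (hρ : ¬ ρ.IsTrivial) {v : V} (hv : v ∈ ρ.invariants) :
    v = 0 := by
  by_contra hv0
  have htop : ρ.invariants = ⊤ :=
    eq_top_of_rep_mem (ρ := ρ) (fun g x hx => by rwa [hx g]) hv hv0
  have hmem : ∀ x, x ∈ ρ.invariants := fun x => htop ▸ Submodule.mem_top
  exact hρ ⟨fun g => LinearMap.ext fun x => hmem x g⟩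

end Irreducible

section Induced

variable {G : Type*} [Group G] {V : Type*} [AddCommGroup V] [Module ℂ V]
  (S : Subgroup G) (σ : Representation ℂ S V)

open Classical in
/-- The element of the induced representation supported on the coset `S g₀` with value `v`
at `g₀`. -/
def inducedDelta (g₀ : G) (v : V) : Representation.coindV S.subtype σ :=
  ⟨fun g => if h : g * g₀⁻¹ ∈ S then σ ⟨g * g₀⁻¹, h⟩ v else 0, by
    rw [Representation.mem_coindV]
    intro s g
    have hiff : S.subtype s * g * g₀⁻¹ ∈ S ↔ g * g₀⁻¹ ∈ S := by
      rw [mul_assoc]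
      exact S.mul_mem_cancel_left s.2
    by_cases h : g * g₀⁻¹ ∈ S
    · rw [dif_pos h, dif_pos (hiff.2 h), ← Module.End.mul_apply, ← map_mul]
      congr 2
      exact Subtype.ext (mul_assoc _ _ _)
    · rw [dif_neg h, dif_neg (mt hiff.1 h), map_zero]⟩

variable {S}

theorem inducedDelta_of_mem {g₀ g : G} (v : V) (h : g * g₀⁻¹ ∈ S) :
    (inducedDelta S σ g₀ v).1 g = σ ⟨g * g₀⁻¹, h⟩ v := dif_pos h

theorem inducedDelta_of_notMem {g₀ g : G} (v : V) (h : g * g₀⁻¹ ∉ S) :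
    (inducedDelta S σ g₀ v).1 g = 0 := dif_neg h

theorem inducedDelta_self (g₀ : G) (v : V) : (inducedDelta S σ g₀ v).1 g₀ = v := by
  have h : g₀ * g₀⁻¹ ∈ S := by simp
  rw [inducedDelta_of_mem σ v h, show (⟨_, h⟩ : S) = 1 from Subtype.ext (mul_inv_cancel g₀),
    map_one, Module.End.one_apply]

theorem induced_apply_apply (g : G) (f : Representation.coindV S.subtype σ) (x : G) :
    (induced S σ g f).1 x = f.1 (x * g) := rfl

variable {σ} in
theorem coindV_mul (f : Representation.coindV S.subtype σ) (s : S) (g : G) :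
    f.1 (s * g) = σ s (f.1 g) := f.2 s g

variable {σ} in
theorem eq_inducedDelta_of_eq_zero {f : Representation.coindV S.subtype σ}
    (h : ∀ g ∉ S, f.1 g = 0) : f = inducedDelta S σ 1 (f.1 1) := by
  refine Subtype.ext (funext fun g => ?_)
  by_cases hg : g ∈ S
  · have hf := coindV_mul f ⟨g, hg⟩ 1
    have hδ := coindV_mul (inducedDelta S σ 1 (f.1 1)) ⟨g, hg⟩ 1
    rw [inducedDelta_self, ← hf, mul_one] at hδ
    exact hδ.symm
  · rw [h g hg, inducedDelta_of_notMem _ _ (by simpa using hg)]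

theorem card_smul_eq_sum_induced_inducedDelta [Fintype G]
    (f : Representation.coindV S.subtype σ) :
    (Nat.card S : ℂ) • f = ∑ g : G, induced S σ g⁻¹ (inducedDelta S σ 1 (f.1 g)) := by
  classical
  ext x
  have hterm : ∀ g : G, (induced S σ g⁻¹ (inducedDelta S σ 1 (f.1 g))).1 x =
      if x * g⁻¹ ∈ S then f.1 x else 0 := by
    intro g
    rw [induced_apply_apply]
    split_ifs with h
    · rw [inducedDelta_of_mem σ _ (by simpa using h), ← coindV_mul]
      simp
    · exact inducedDelta_of_notMem _ _ (by simpa using h)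
  have hcard : (Finset.univ.filter fun g : G => x * g⁻¹ ∈ S).card = Nat.card S := by
    rw [Nat.card_eq_fintype_card, ← Finset.card_univ]
    refine Finset.card_bij' (fun g hg => ⟨x * g⁻¹, by simpa using hg⟩)
      (fun s _ => (s : G)⁻¹ * x) ?_ ?_ ?_ ?_ <;> simp
  rw [AddSubmonoidClass.coe_finsetSum, Finset.sum_apply, Finset.sum_congr rfl fun g _ => hterm g,
    ← Finset.sum_filter, Finset.sum_const, hcard, ← Nat.cast_smul_eq_nsmul ℂ]
  rfl

variable {σ} in
theorem eq_top_of_inducedDelta_mem [Finite G]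
    {p : Submodule ℂ (Representation.coindV S.subtype σ)}
    (hp : ∀ g, ∀ f ∈ p, induced S σ g f ∈ p) (h : ∀ v, inducedDelta S σ 1 v ∈ p) : p = ⊤ := by
  have := Fintype.ofFinite G
  have hcard : (Nat.card S : ℂ) ≠ 0 := by exact_mod_cast Nat.card_pos.ne'
  refine eq_top_iff.2 fun f _ => ?_
  rw [← Submodule.smul_mem_iff p hcard, card_smul_eq_sum_induced_inducedDelta]
  exact Submodule.sum_mem _ fun g _ => hp _ _ (h _)

variable (U : Subgroup G) [Finite U] (θ : U →* ℂ)

theorem twistProj_induced_apply [Fintype U] (f : Representation.coindV S.subtype σ) (g : G) :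
    (twistProj (induced S σ) U θ f).1 g = ∑ u : U, θ u⁻¹ • f.1 (g * u) := by
  rw [twistProj_apply, AddSubmonoidClass.coe_finsetSum, Finset.sum_apply]
  rfl

theorem twistProj_induced_mul (f : Representation.coindV S.subtype σ) (g : G) (u : U) :
    (twistProj (induced S σ) U θ f).1 (g * u) =
      θ u • (twistProj (induced S σ) U θ f).1 g := by
  rw [← induced_apply_apply, rep_twistProj]
  rfl

theorem twistProj_inducedDelta_eq_zero {g₀ g : G} (v : V) (h : ∀ u ∈ U, g * u * g₀⁻¹ ∉ S) :
    (twistProj (induced S σ) U θ (inducedDelta S σ g₀ v)).1 g = 0 := by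
  have := Fintype.ofFinite U
  rw [twistProj_induced_apply]
  exact Finset.sum_eq_zero fun u _ => by rw [inducedDelta_of_notMem _ _ (h u u.2), smul_zero]

theorem exists_twistProj_inducedDelta_eq {W : Type*} [AddCommGroup W] [Module ℂ W]
    {μ : V →ₗ[ℂ] W} (hsurj : Function.Surjective μ) (g₀ : G)
    (hμ : ∀ (u : U) (s : S) (v : V), (s : G) = g₀ * u * g₀⁻¹ → μ (σ s v) = θ u • μ v) (w : W) :
    ∃ v, μ ((twistProj (induced S σ) U θ (inducedDelta S σ g₀ v)).1 g₀) = w := by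
  classical
  have := Fintype.ofFinite U
  let stab := Finset.univ.filter fun u : U => g₀ * u * g₀⁻¹ ∈ S
  have hcard : (stab.card : ℂ) ≠ 0 := by
    rw [Nat.cast_ne_zero, ← Nat.pos_iff_ne_zero, Finset.card_pos]
    exact ⟨1, by simp [stab]⟩
  have hval (v : V) : μ ((twistProj (induced S σ) U θ (inducedDelta S σ g₀ v)).1 g₀) =
      (stab.card : ℂ) • μ v := by
    rw [twistProj_induced_apply, map_sum, Nat.cast_smul_eq_nsmul, ← Finset.sum_const,
      Finset.sum_filter]
    refine Finset.sum_congr rfl fun u _ => ?_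
    split_ifs with h
    · rw [inducedDelta_of_mem _ _ h, map_smul, hμ u _ v rfl, smul_smul,
        map_mul_eq_one θ (inv_mul_cancel u), one_smul]
    · rw [inducedDelta_of_notMem _ _ h, smul_zero, map_zero]
  obtain ⟨v, hv⟩ := hsurj ((stab.card : ℂ)⁻¹ • w)
  exact ⟨v, by rw [hval, hv, smul_inv_smul₀ hcard]⟩

end Induced

section Equivs

variable {G H : Type*} [Group G] [Group H] {V V' W W' : Type*}
  [AddCommGroup V] [Module ℂ V] [AddCommGroup V'] [Module ℂ V']
  [AddCommGroup W] [Module ℂ W] [AddCommGroup W'] [Module ℂ W']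
  {ρ : Representation ℂ G V} {ρ' : Representation ℂ G V'}
  {σ : Representation ℂ G W} {σ' : Representation ℂ G W'}

variable (ρ σ) in
theorem nonempty_prod_equiv_right [Subsingleton V] : Nonempty ((ρ.prod σ).Equiv σ) :=
  ⟨(Representation.IntertwiningMap.snd ℂ ρ σ).ofBijective
    ⟨fun _ _ h => Prod.ext (Subsingleton.elim _ _) h, Prod.snd_surjective⟩⟩

variable (ρ σ) in
theorem nonempty_prod_equiv_left [Subsingleton W] : Nonempty ((ρ.prod σ).Equiv ρ) :=
  ⟨(Representation.IntertwiningMap.fst ℂ ρ σ).ofBijective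
    ⟨fun _ _ h => Prod.ext h (Subsingleton.elim _ _), Prod.fst_surjective⟩⟩

/-- The direct sum of two isomorphisms of representations. -/
def prodEquiv (e : ρ.Equiv ρ') (f : σ.Equiv σ') : (ρ.prod σ).Equiv (ρ'.prod σ') :=
  .mk (e.toLinearEquiv.prodCongr f.toLinearEquiv) fun g => LinearMap.ext fun x =>
    Prod.ext (e.isIntertwining _ _ g x.1) (f.isIntertwining _ _ g x.2)

/-- The pullback of an isomorphism of representations along a group homomorphism. -/
def compEquiv (φ : H →* G) (e : ρ.Equiv ρ') :
    Representation.Equiv (ρ.comp φ) (ρ'.comp φ) :=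
  .mk e.toLinearEquiv fun h => LinearMap.ext (e.isIntertwining _ _ (φ h))

/-- Induction of an isomorphism of representations. -/
def inducedEquiv {S : Subgroup G} {σ : Representation ℂ S W} {σ' : Representation ℂ S W'}
    (e : σ.Equiv σ') : (induced S σ).Equiv (induced S σ') :=
  (Representation.coindMap S.subtype e.toIntertwiningMap).ofBijective <| by
    refine Function.bijective_iff_has_inverse.2
      ⟨Representation.coindMap S.subtype e.symm.toIntertwiningMap, fun f => ?_, fun f => ?_⟩
    · ext x
      exact e.symm_apply_apply _
    · ext x
      exact e.apply_symm_apply _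

end Equivs

section SL2Elements

variable {F : Type*} [Field F]

/-- The upper triangular unipotent matrix with entry `x`. -/
def unip (x : F) : SL2 F := ⟨!![1, x; 0, 1], by simp [Matrix.det_fin_two]⟩

/-- The matrix `unip x` as an element of `N_{1,1}`. -/
def unipN (x : F) : N11 F := ⟨unip x, x, rfl⟩

theorem coe_unipN (x : F) : (unipN x : SL2 F) = unip x := rfl

theorem unip_add (x y : F) : unip (x + y) = unip x * unip y := by
  apply Subtype.ext
  rw [Matrix.SpecialLinearGroup.coe_mul]
  simp [unip, add_comm]

theorem unipN_add (x y : F) : unipN (x + y) = unipN x * unipN y := Subtype.ext (unip_add x y)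

theorem exists_unipN (n : N11 F) : ∃ x : F, n = unipN x := by
  obtain ⟨n, x, hx⟩ := n
  exact ⟨x, Subtype.ext (Subtype.ext hx)⟩

theorem unipN_injective : Function.Injective (unipN : F → N11 F) := by
  intro x y h
  simpa [unipN, unip] using congrArg (fun n : N11 F => (n : SL2 F).1 0 1) h

/-- The parametrization of `N_{1,1}` by `F`. -/
def unipEquiv : F ≃ N11 F :=
  Equiv.ofBijective unipN ⟨unipN_injective, fun n => (exists_unipN n).imp fun _ h => h.symm⟩

theorem unipEquiv_apply (x : F) : unipEquiv x = unipN x := rfl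

theorem unipN_zero : unipN (0 : F) = 1 := by
  ext i j
  fin_cases i <;> fin_cases j <;> simp [unipN, unip]

theorem unipN_neg (x : F) : unipN (-x) = (unipN x)⁻¹ := by
  rw [eq_inv_iff_mul_eq_one, ← unipN_add, neg_add_cancel, unipN_zero]

theorem exists_map_unipN_ne_one {θ : N11 F →* ℂ} (hθ : θ ≠ 1) : ∃ x, θ (unipN x) ≠ 1 := by
  by_contra! h
  refine hθ (MonoidHom.ext fun n => ?_)
  obtain ⟨x, rfl⟩ := exists_unipN n
  exact h x

theorem psiN11_unipN (ψ₀ : AddChar F ℂ) (c x : F) : psiN11 ψ₀ c (unipN x) = ψ₀ (c * x) := rfl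

theorem psiN11_zero (ψ₀ : AddChar F ℂ) : psiN11 ψ₀ (0 : F) = 1 := by
  ext n
  simp [psiN11]

theorem psiN11_ne_one {ψ₀ : AddChar F ℂ} (hψ₀ : ψ₀ ≠ 1) (c : Fˣ) : psiN11 ψ₀ (c : F) ≠ 1 := by
  obtain ⟨x, hx⟩ := AddChar.ne_one_iff.1 hψ₀
  intro h
  refine hx ?_
  simpa [psiN11_unipN] using DFunLike.congr_fun h (unipN (↑c⁻¹ * x))

theorem torus_mul_unip (y : Fˣ) (x : F) : torus y * unip x = unip (y * x * y) * torus y := by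
  apply Subtype.ext
  simp only [Matrix.SpecialLinearGroup.coe_mul]
  simp [unip, coe_torus]

/-- The antidiagonal element with lower left entry `c`. -/
def antidiag (c : Fˣ) : SL2 F :=
  ⟨!![0, -((c⁻¹ : Fˣ) : F); (c : F), 0], by simp [Matrix.det_fin_two]⟩

theorem det_entries (g : SL2 F) : g.1 0 0 * g.1 1 1 - g.1 0 1 * g.1 1 0 = 1 := by
  rw [← Matrix.det_fin_two, g.det_coe]

theorem eq_unip_mul_antidiag_mul_unip (g : SL2 F) (c : Fˣ) (hc : g.1 1 0 = c) :
    g = unip (g.1 0 0 * (c⁻¹ : Fˣ)) * antidiag c * unip (g.1 1 1 * (c⁻¹ : Fˣ)) := by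
  have hdet := det_entries g
  have hc0 : (c : F) ≠ 0 := c.ne_zero
  rw [hc] at hdet
  have h01 : g.1 0 1 = g.1 0 0 * (g.1 1 1 * (c : F)⁻¹) + -(c : F)⁻¹ := by
    field_simp
    linear_combination -hdet
  have h11 : (c : F) * (g.1 1 1 * (c : F)⁻¹) = g.1 1 1 := by field_simp
  apply Subtype.ext
  rw [Matrix.eta_fin_two g.1, hc, h01]
  simp only [Matrix.SpecialLinearGroup.coe_mul]
  simp [unip, antidiag, h11]

/-- The anti-involution of `SL₂` exchanging the diagonal entries. -/
def antiFlip (g : SL2 F) : SL2 F :=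
  ⟨!![g.1 1 1, g.1 0 1; g.1 1 0, g.1 0 0], by
    rw [Matrix.det_fin_two_of, mul_comm, det_entries]⟩

theorem antiFlip_mul (g h : SL2 F) : antiFlip (g * h) = antiFlip h * antiFlip g := by
  apply Subtype.ext
  rw [Matrix.SpecialLinearGroup.coe_mul]
  ext i j
  fin_cases i <;> fin_cases j <;>
    simp [antiFlip, Matrix.mul_apply, Fin.sum_univ_two, mul_comm, add_comm]

theorem antiFlip_of_mem_N11 (n : N11 F) : antiFlip (n : SL2 F) = n := by
  obtain ⟨x, rfl⟩ := exists_unipN n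
  rfl

theorem exists_mul_unip_eq {g : SL2 F} (hc : g.1 1 0 = 0) (hne : g.1 0 0 ≠ g.1 1 1) (x : F) :
    ∃ z, g * unip z = unip (z + x) * g := by
  have hsub : g.1 0 0 - g.1 1 1 ≠ 0 := sub_ne_zero.2 hne
  refine ⟨x * g.1 1 1 / (g.1 0 0 - g.1 1 1), Subtype.ext ?_⟩
  have h01 : g.1 0 0 * (x * g.1 1 1 / (g.1 0 0 - g.1 1 1)) =
      (x * g.1 1 1 / (g.1 0 0 - g.1 1 1) + x) * g.1 1 1 := by
    field_simp
    ring
  rw [Matrix.SpecialLinearGroup.coe_mul, Matrix.SpecialLinearGroup.coe_mul,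
    Matrix.eta_fin_two g.1]
  simp [unip, hc, h01, add_comm]

end SL2Elements

section Whittaker

variable {F : Type*} [Field F] [Finite F] {V : Type*} [AddCommGroup V] [Module ℂ V]
  (τ : Representation ℂ (SL2 F) V)

/-- The Bessel operator of `g` for the character `θ` of `N_{1,1}`; for `θ ≠ 1` these operators
commute, which is the multiplicity one property of the Gelfand–Graev representation. -/
def bessel (θ : N11 F →* ℂ) (g : SL2 F) : V →ₗ[ℂ] V :=
  twistProj τ (N11 F) θ ∘ₗ τ g ∘ₗ twistProj τ (N11 F) θ

theorem bessel_apply (θ : N11 F →* ℂ) (g : SL2 F) (v : V) :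
    bessel τ θ g v = twistProj τ (N11 F) θ (τ g (twistProj τ (N11 F) θ v)) := rfl

theorem bessel_mul_left (θ : N11 F →* ℂ) (n : N11 F) (g : SL2 F) :
    bessel τ θ (n * g) = θ n • bessel τ θ g := by
  ext v
  simp [bessel_apply, twistProj_rep]

theorem bessel_mul_right (θ : N11 F →* ℂ) (n : N11 F) (g : SL2 F) :
    bessel τ θ (g * n) = θ n • bessel τ θ g := by
  ext v
  simp [bessel_apply, rep_twistProj]

theorem bessel_eq_zero_of_upper {θ : N11 F →* ℂ} (hθ : θ ≠ 1) {g : SL2 F}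
    (hc : g.1 1 0 = 0) (hne : g.1 0 0 ≠ g.1 1 1) : bessel τ θ g = 0 := by
  obtain ⟨x, hx⟩ := exists_map_unipN_ne_one hθ
  obtain ⟨z, hz⟩ := exists_mul_unip_eq hc hne x
  have h := bessel_mul_right τ θ (unipN z) g
  rw [coe_unipN, hz, ← coe_unipN, bessel_mul_left, unipN_add, map_mul, mul_smul] at h
  have hθz : θ (unipN z) ≠ 0 :=
    left_ne_zero_of_mul_eq_one (map_mul_eq_one θ (mul_inv_cancel (unipN z)))
  have hfix : (θ (unipN x) - 1) • bessel τ θ g = 0 := by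
    rw [sub_smul, one_smul, sub_eq_zero]
    exact smul_right_injective _ hθz h
  exact (smul_eq_zero.1 hfix).resolve_left (sub_ne_zero.2 hx)

theorem bessel_antiFlip {θ : N11 F →* ℂ} (hθ : θ ≠ 1) (g : SL2 F) :
    bessel τ θ (antiFlip g) = bessel τ θ g := by
  by_cases hc : g.1 1 0 = 0
  · by_cases hdiag : g.1 0 0 = g.1 1 1
    · congr 1
      apply Subtype.ext
      ext i j
      fin_cases i <;> fin_cases j <;> simp [antiFlip, hdiag]
    · rw [bessel_eq_zero_of_upper τ hθ hc hdiag,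
        bessel_eq_zero_of_upper τ hθ (g := antiFlip g) hc (Ne.symm hdiag)]
  · conv_rhs => rw [eq_unip_mul_antidiag_mul_unip g (Units.mk0 _ hc) rfl]
    rw [eq_unip_mul_antidiag_mul_unip (antiFlip g) (Units.mk0 _ hc) rfl]
    simp only [← coe_unipN, bessel_mul_left, bessel_mul_right, smul_smul]
    rw [mul_comm]
    rfl

theorem bessel_bessel [Fintype (N11 F)] (θ : N11 F →* ℂ) (g h : SL2 F) (v : V) :
    bessel τ θ g (bessel τ θ h v) =
      (Nat.card (N11 F) : ℂ) • ∑ n : N11 F, θ n⁻¹ • bessel τ θ (g * n * h) v := by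
  rw [bessel_apply, bessel_apply, twistProj_eq_card_smul τ _ θ fun u => rep_twistProj τ _ θ u _,
    map_smul, map_smul, twistProj_apply τ (N11 F) θ (τ h _), map_sum, map_sum]
  congr 1
  refine Finset.sum_congr rfl fun n _ => ?_
  rw [map_smul, map_smul, bessel_apply, map_mul, map_mul]
  rfl

theorem bessel_comm {θ : N11 F →* ℂ} (hθ : θ ≠ 1) (g h : SL2 F) (v : V) :
    bessel τ θ g (bessel τ θ h v) = bessel τ θ h (bessel τ θ g v) := by
  have := Fintype.ofFinite (N11 F)
  calc bessel τ θ g (bessel τ θ h v)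
      = bessel τ θ (antiFlip h) (bessel τ θ (antiFlip g) v) := by
        rw [bessel_bessel, bessel_bessel]
        congr 1
        refine Finset.sum_congr rfl fun n _ => ?_
        rw [← bessel_antiFlip τ hθ (g * n * h), antiFlip_mul, antiFlip_mul, antiFlip_of_mem_N11,
          mul_assoc]
    _ = bessel τ θ h (bessel τ θ g v) := by rw [bessel_antiFlip τ hθ, bessel_antiFlip τ hθ]

theorem finrank_jacquetSpace_le_one [τ.IsIrreducible] {θ : N11 F →* ℂ} (hθ : θ ≠ 1) :
    Module.finrank ℂ (JacquetSpace τ (N11 F) θ) ≤ 1 := by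
  have hcard : (Nat.card (N11 F) : ℂ) ≠ 0 := by exact_mod_cast Nat.card_pos.ne'
  rw [finrank_jacquetSpace]
  refine finrank_range_le_one_of_commute (ρ := τ) fun g h v => ?_
  have hcomm := bessel_comm τ hθ g h v
  simp only [bessel_apply, map_smul,
    twistProj_eq_card_smul τ _ θ fun u => rep_twistProj τ _ θ u _] at hcomm
  exact smul_right_injective V hcard hcomm

end Whittaker

section Orbits

variable {F : Type*} [Field F] {V : Type*} [AddCommGroup V] [Module ℂ V]
  {τ : Representation ℂ (SL2 F) V}

theorem InTorusOrbit.symm {Ψ θ : N11 F →* ℂ} (h : InTorusOrbit Ψ θ) : InTorusOrbit θ Ψ := by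
  obtain ⟨y, hy⟩ := h
  exact ⟨y⁻¹, fun n n' hn => (hy n' n (by rw [hn]; simp [mul_assoc])).symm⟩

theorem subsingleton_jacquetSpace_of_inTorusOrbit {Ψ θ : N11 F →* ℂ} (h : InTorusOrbit Ψ θ)
    (hΨ : Subsingleton (JacquetSpace τ (N11 F) Ψ)) :
    Subsingleton (JacquetSpace τ (N11 F) θ) := by
  rw [Submodule.Quotient.subsingleton_iff] at hΨ ⊢
  obtain ⟨y, hy⟩ := h
  have hle : twistedKer τ (N11 F) Ψ ≤ (twistedKer τ (N11 F) θ).comap (τ (torus y)) := by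
    refine Submodule.span_le.2 ?_
    rintro _ ⟨n, v, rfl⟩
    refine Submodule.subset_span ⟨⟨_, torus_conj_mem y n n.2⟩, τ (torus y) v, ?_⟩
    rw [hy ⟨_, torus_conj_mem y n n.2⟩ n (by simp [mul_assoc])]
    simp [← Module.End.mul_apply, ← map_mul]
  rw [hΨ, top_le_iff] at hle
  refine eq_top_iff.2 fun v _ => ?_
  have hv : τ (torus y)⁻¹ v ∈ (twistedKer τ (N11 F) θ).comap (τ (torus y)) :=
    hle ▸ Submodule.mem_top
  simpa [← Module.End.mul_apply, ← map_mul] using hv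

theorem nontrivial_jacquetSpace_of_inTorusOrbit {Ψ θ : N11 F →* ℂ} (h : InTorusOrbit Ψ θ)
    (hΨ : Nontrivial (JacquetSpace τ (N11 F) Ψ)) :
    Nontrivial (JacquetSpace τ (N11 F) θ) := by
  rw [← not_subsingleton_iff_nontrivial] at hΨ ⊢
  exact mt (subsingleton_jacquetSpace_of_inTorusOrbit h.symm) hΨ

theorem inTorusOrbit_psiN11 (ψ₀ : AddChar F ℂ) (a : F) (s : Fˣ) :
    InTorusOrbit (psiN11 ψ₀ a) (psiN11 ψ₀ (a * (s * s))) := by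
  refine ⟨s⁻¹, fun n n' hn => ?_⟩
  obtain ⟨x, rfl⟩ := exists_unipN n
  have hn' : n' = unipN (s * x * s) := by
    apply Subtype.ext
    rw [hn, coe_unipN, coe_unipN, map_inv, inv_inv, torus_mul_unip, mul_inv_cancel_right]
  rw [hn', psiN11_unipN, psiN11_unipN]
  congr 1
  ring

theorem exists_eq_psiN11 [Finite F] {ψ₀ : AddChar F ℂ} (hψ₀ : ψ₀ ≠ 1) (Ψ : N11 F →* ℂ) :
    ∃ c : F, Ψ = psiN11 ψ₀ c := by
  have := Fintype.ofFinite F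
  let φ : AddChar F ℂ :=
    { toFun := fun x => Ψ (unipN x)
      map_zero_eq_one' := by
        rw [unipN_zero, map_one]
      map_add_eq_mul' := fun x y => by rw [unipN_add, map_mul] }
  have hinj : Function.Injective ψ₀.mulShift :=
    AddChar.to_mulShift_inj_of_isPrimitive (AddChar.IsPrimitive.of_ne_one hψ₀)
  obtain ⟨c, hc⟩ :=
    ((Fintype.bijective_iff_injective_and_card _).2 ⟨hinj, AddChar.card_eq.symm⟩).2 φ
  refine ⟨c, MonoidHom.ext fun n => ?_⟩
  obtain ⟨x, rfl⟩ := exists_unipN n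
  exact (DFunLike.congr_fun hc x).symm

theorem exists_eq_psiN11_of_ne_one [Finite F] {ψ₀ : AddChar F ℂ} (hψ₀ : ψ₀ ≠ 1)
    {Ψ : N11 F →* ℂ} (hΨ : Ψ ≠ 1) : ∃ c : Fˣ, Ψ = psiN11 ψ₀ (c : F) := by
  obtain ⟨c, rfl⟩ := exists_eq_psiN11 hψ₀ Ψ
  have hc : c ≠ 0 := fun h => hΨ (by rw [h, psiN11_zero])
  exact ⟨Units.mk0 c hc, rfl⟩

theorem quadraticChar_eq_neg_one_of_not_inTorusOrbit [Fintype F] [DecidableEq F]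
    {ψ₀ : AddChar F ℂ} {a b : Fˣ}
    (hab : ¬ InTorusOrbit (psiN11 ψ₀ (a : F)) (psiN11 ψ₀ (b : F))) :
    quadraticChar F (b / a) = -1 := by
  rw [quadraticChar_neg_one_iff_not_isSquare]
  rintro ⟨s, hs⟩
  have hs0 : s ≠ 0 := fun h0 => by simp [h0] at hs
  have hb : (b : F) = a * (s * s) := by rw [← hs, mul_div_cancel₀ _ a.ne_zero]
  exact hab (hb ▸ inTorusOrbit_psiN11 ψ₀ (a : F) (Units.mk0 s hs0))

theorem inTorusOrbit_or_inTorusOrbit [Finite F] {ψ₀ : AddChar F ℂ} (hψ₀ : ψ₀ ≠ 1)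
    {Ψ Ψ' θ : N11 F →* ℂ} (hΨ : Ψ ≠ 1) (hΨ' : Ψ' ≠ 1) (hθ : θ ≠ 1) (h : ¬ InTorusOrbit Ψ Ψ') :
    InTorusOrbit Ψ θ ∨ InTorusOrbit Ψ' θ := by
  classical
  have := Fintype.ofFinite F
  obtain ⟨a, rfl⟩ := exists_eq_psiN11_of_ne_one hψ₀ hΨ
  obtain ⟨b, rfl⟩ := exists_eq_psiN11_of_ne_one hψ₀ hΨ'
  obtain ⟨c, rfl⟩ := exists_eq_psiN11_of_ne_one hψ₀ hθ
  by_contra! hno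
  have hca := quadraticChar_eq_neg_one_of_not_inTorusOrbit hno.1
  have hprod : (c / a : F) = (c / b) * (b / a) := (div_mul_div_cancel₀ b.ne_zero).symm
  rw [hprod, map_mul, quadraticChar_eq_neg_one_of_not_inTorusOrbit hno.2,
    quadraticChar_eq_neg_one_of_not_inTorusOrbit h] at hca
  norm_num at hca

end Orbits

section Degenerate

open scoped commutatorElement

variable {F : Type*} [Field F] {V : Type*} [AddCommGroup V] [Module ℂ V]
  {τ : Representation ℂ (SL2 F) V}

theorem subsingleton_jacquetSpace_of_rep_eq_one {θ : N11 F →* ℂ} (hθ : θ ≠ 1)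
    (h : ∀ n : N11 F, τ (n : SL2 F) = 1) : Subsingleton (JacquetSpace τ (N11 F) θ) := by
  obtain ⟨x, hx⟩ := exists_map_unipN_ne_one hθ
  refine Submodule.Quotient.subsingleton_iff.2 (eq_top_iff.2 fun v _ => ?_)
  have hv : (1 - θ (unipN x)) • v ∈ twistedKer τ (N11 F) θ :=
    Submodule.subset_span ⟨unipN x, v, by rw [h, sub_smul, one_smul, Module.End.one_apply]⟩
  exact (Submodule.smul_mem_iff _ (sub_ne_zero.2 hx.symm)).1 hv

theorem exists_sq_ne_one [Fintype F] (hF : 3 < Fintype.card F) : ∃ y : Fˣ, y ^ 2 ≠ 1 := by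
  obtain ⟨y, hy⟩ := IsCyclic.exists_ofOrder_eq_natCard (α := Fˣ)
  refine ⟨y, fun h => ?_⟩
  have hle := orderOf_le_of_pow_eq_one two_pos h
  rw [hy, Nat.card_units, Nat.card_eq_fintype_card] at hle
  lia

theorem exists_unip_eq_commutator {y : Fˣ} (hy : y ^ 2 ≠ 1) (z : F) :
    ∃ x, unip z = ⁅torus y, unip x⁆ := by
  have hy0 : (y : F) * y - 1 ≠ 0 := by
    rw [sub_ne_zero, ← sq]
    exact fun h => hy (Units.ext (by simpa using h))
  refine ⟨z / (y * y - 1), ?_⟩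
  have hz : (y : F) * (z / (y * y - 1)) * y = z + z / (y * y - 1) := by
    linear_combination div_mul_cancel₀ z hy0
  rw [commutatorElement_def, torus_mul_unip, hz, unip_add, mul_inv_cancel_right,
    mul_inv_cancel_right]

theorem rep_commutator_of_finrank_eq_one {G : Type*} [Group G] {ρ : Representation ℂ G V}
    (hV : Module.finrank ℂ V = 1) (g h : G) : ρ ⁅g, h⁆ = 1 := by
  have hcomm : ρ g * ρ h = ρ h * ρ g := by
    obtain ⟨a, ha, -⟩ := (ρ g).existsUnique_eq_smul_id_of_finrank_eq_one hV
    rw [ha]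
    ext v
    simp
  calc ρ ⁅g, h⁆ = ρ g * ρ h * ρ (g⁻¹ * h⁻¹) := by
        rw [← map_mul, ← map_mul, commutatorElement_def]
        simp only [mul_assoc]
    _ = 1 := by rw [hcomm, ← map_mul, ← map_mul]; simp

theorem subsingleton_jacquetSpace_of_finrank_eq_one [Fintype F] (hV : Module.finrank ℂ V = 1)
    (htriv : Fintype.card F ≤ 3 → τ.IsTrivial) {θ : N11 F →* ℂ} (hθ : θ ≠ 1) :
    Subsingleton (JacquetSpace τ (N11 F) θ) := by
  refine subsingleton_jacquetSpace_of_rep_eq_one hθ fun n => ?_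
  rcases le_or_gt (Fintype.card F) 3 with hcard | hcard
  · exact (htriv hcard).out n
  · obtain ⟨y, hy⟩ := exists_sq_ne_one hcard
    obtain ⟨z, rfl⟩ := exists_unipN n
    obtain ⟨x, hx⟩ := exists_unip_eq_commutator hy z
    rw [coe_unipN, hx, rep_commutator_of_finrank_eq_one hV]

end Degenerate

section PrincipalSeries

variable {F : Type*} [Field F] {V : Type*} [AddCommGroup V] [Module ℂ V]
  {τ : Representation ℂ (SL2 F) V}

theorem mul_unip_apply_one_one (g : SL2 F) (x : F) :
    (g * unip x).1 1 1 = g.1 1 0 * x + g.1 1 1 := by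
  rw [Matrix.SpecialLinearGroup.coe_mul]
  simp [unip, Matrix.mul_apply, Fin.sum_univ_two]

theorem mul_antidiag_inv_mem_borel_iff (g : SL2 F) :
    g * (antidiag 1)⁻¹ ∈ borel F ↔ g.1 1 1 = 0 := by
  change (g * (antidiag 1)⁻¹ : SL2 F).1 1 0 = 0 ↔ _
  rw [Matrix.SpecialLinearGroup.coe_mul, Matrix.SpecialLinearGroup.coe_inv]
  simp [antidiag, Matrix.mul_apply, Fin.sum_univ_two, Matrix.adjugate_fin_two]

theorem nontrivial_jacquetSpace_of_isPrincipalSeries [Finite F] (hτ : IsPrincipalSeries τ)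
    (θ : N11 F →* ℂ) : Nontrivial (JacquetSpace τ (N11 F) θ) := by
  obtain ⟨χ, ⟨e⟩⟩ := hτ
  obtain ⟨v, hv⟩ := exists_twistProj_inducedDelta_eq (charRep (χ.comp borelToTorus)) (N11 F) θ
    (μ := LinearMap.id) Function.surjective_id (antidiag 1) (fun u s v hs => by
      obtain ⟨x, rfl⟩ := exists_unipN u
      have hmem := (mul_antidiag_inv_mem_borel_iff _).1 (hs ▸ s.2)
      rw [coe_unipN, mul_unip_apply_one_one] at hmem
      obtain rfl : x = 0 := by simpa [antidiag] using hmem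
      have hs1 : s = 1 := Subtype.ext (by rw [hs, unipN_zero]; simp)
      simp [hs1, unipN_zero]) 1
  let δ : Representation.coindV _ _ := inducedDelta (borel F) (charRep (χ.comp borelToTorus))
    (antidiag 1) v
  refine (nontrivial_jacquetSpace_iff τ (N11 F) θ).2 ⟨e.symm δ, fun h => ?_⟩
  have hzero : twistProj (principalSeries χ) (N11 F) θ δ = 0 := by
    have hmap := map_twistProj (N11 F) θ e.toIntertwiningMap (e.symm δ)
    rw [h, map_zero] at hmap
    simpa using hmap.symm
  rw [hzero] at hv
  exact zero_ne_one hv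

end PrincipalSeries

section Steinberg

variable {F : Type*} [Field F]

theorem unip_mem_borel (x : F) : unip x ∈ borel F := by
  change (unip x).1 1 0 = 0
  simp [unip]

theorem eq_ite_of_borel_invariant [DecidableEq F] {f : SL2 F → ℂ}
    (hB : ∀ b ∈ borel F, ∀ g, f (b * g) = f g) (hN : ∀ g x, f (g * unip x) = f g) (g : SL2 F) :
    f g = if g.1 1 0 = 0 then f 1 else f (antidiag 1) := by
  split_ifs with hg
  · simpa using hB g hg 1
  · have hb : g * unip (-(g.1 1 1 / g.1 1 0)) * (antidiag 1)⁻¹ ∈ borel F := by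
      rw [mul_antidiag_inv_mem_borel_iff, mul_unip_apply_one_one]
      field_simp
      ring
    rw [← hN g, ← hB _ hb (antidiag 1), inv_mul_cancel_right]

theorem antidiag_mul_unip_mul_antidiag_apply_one_zero (x : F) :
    (antidiag 1 * unip x * antidiag 1 : SL2 F).1 1 0 = x := by
  rw [Matrix.SpecialLinearGroup.coe_mul, Matrix.SpecialLinearGroup.coe_mul]
  simp [antidiag, unip, Matrix.mul_apply, Fin.sum_univ_two]

theorem eq_one_of_borel_invariant_of_sum_eq_zero [Fintype (N11 F)] {f : SL2 F → ℂ}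
    (hB : ∀ b ∈ borel F, ∀ g, f (b * g) = f g) (hN : ∀ g x, f (g * unip x) = f g)
    {θ : N11 F →* ℂ} (hθ : θ ≠ 1)
    (hsum : ∑ n : N11 F, θ n⁻¹ * f (antidiag 1 * (n : SL2 F) * antidiag 1) = 0) (g : SL2 F) :
    f g = f 1 := by
  classical
  have hval : ∀ n : N11 F, f (antidiag 1 * (n : SL2 F) * antidiag 1) =
      f (antidiag 1) + if n = 1 then f 1 - f (antidiag 1) else 0 := by
    intro n
    obtain ⟨x, rfl⟩ := exists_unipN n
    have hx : unipN x = 1 ↔ x = 0 := by rw [← unipN_zero, unipN_injective.eq_iff]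
    rw [eq_ite_of_borel_invariant hB hN, coe_unipN, antidiag_mul_unip_mul_antidiag_apply_one_zero]
    simp only [hx]
    split_ifs <;> ring
  have hθsum : ∑ n : N11 F, θ n⁻¹ = 0 :=
    (Equiv.sum_comp (Equiv.inv _) θ).trans (sum_hom_units_eq_zero θ hθ)
  have heq : f 1 = f (antidiag 1) := by
    simp only [hval, mul_add, Finset.sum_add_distrib, ← Finset.sum_mul, hθsum, zero_mul, zero_add,
      mul_ite, mul_zero, Finset.sum_ite_eq', Finset.mem_univ, if_true, inv_one, map_one,
      one_mul] at hsum
    exact sub_eq_zero.1 hsum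
  rw [eq_ite_of_borel_invariant hB hN g, ← heq, ite_self]

variable {V : Type*} [AddCommGroup V] [Module ℂ V] {τ : Representation ℂ (SL2 F) V}
  [τ.IsIrreducible]

theorem principalSeries_apply_unip {χ : Fˣ →* ℂˣ}
    (f : Representation.coindV (borel F).subtype (charRep (χ.comp borelToTorus))) (x : F) :
    f.1 (unip x) = f.1 1 := by
  have h := coindV_mul f ⟨unip x, unip_mem_borel x⟩ 1
  have hx : borelToTorus ⟨unip x, unip_mem_borel x⟩ = 1 := by
    ext
    simp [borelToTorus, unip]
  simpa [charRep_apply, hx] using h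

theorem not_isCuspidal_of_isConstituent [Finite F] {χ : Fˣ →* ℂˣ}
    (h : IsConstituent τ (principalSeries χ)) : ¬ IsCuspidal τ := by
  intro hcusp
  have := Fintype.ofFinite (N11 F)
  obtain ⟨i, hi⟩ := h
  have hone : ∀ w, (i w).1 1 = 0 := fun w => by
    have hsum : (twistProj (principalSeries χ) (N11 F) 1 (i w)).1 1 = 0 := by
      rw [← map_twistProj, (subsingleton_jacquetSpace_iff τ _ _).1 hcusp, map_zero]
      rfl
    have hterm : ∀ n : N11 F, (i w).1 (n : SL2 F) = (i w).1 1 := fun n => by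
      obtain ⟨x, rfl⟩ := exists_unipN n
      exact principalSeries_apply_unip (i w) x
    rw [twistProj_induced_apply] at hsum
    simpa [hterm] using hsum
  have := nontrivial_of_isIrreducible τ
  obtain ⟨v, hv⟩ := exists_ne (0 : V)
  refine hv (hi ?_)
  rw [map_zero]
  ext g
  have hg := hone (τ g v)
  rw [i.isIntertwining, induced_apply_apply, one_mul] at hg
  exact hg

theorem nontrivial_jacquetSpace_of_isSteinberg [Finite F] (hτ : IsSteinberg τ)
    {θ : N11 F →* ℂ} (hθ : θ ≠ 1) : Nontrivial (JacquetSpace τ (N11 F) θ) := by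
  have := Fintype.ofFinite (N11 F)
  obtain ⟨htriv, i, hi⟩ := hτ
  by_contra hsub
  rw [not_nontrivial_iff_subsingleton, subsingleton_jacquetSpace_iff] at hsub
  have hrep : ∀ g v x, (i (τ g v)).1 x = (i v).1 (x * g) := fun g v x => by
    rw [i.isIntertwining]
    rfl
  have hB : ∀ v, ∀ b ∈ borel F, ∀ g, (i v).1 (b * g) = (i v).1 g := fun v b hb g => by
    simpa [charRep_apply] using coindV_mul (i v) ⟨b, hb⟩ g
  refine not_isCuspidal_of_isConstituent ⟨i, hi⟩ ?_
  refine (subsingleton_jacquetSpace_iff τ _ _).2 fun v => eq_zero_of_mem_invariants htriv ?_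
  set w := twistProj τ (N11 F) 1 v with hw
  have hN : ∀ g x, (i w).1 (g * unip x) = (i w).1 g := fun g x => by
    rw [← hrep, ← coe_unipN, hw, rep_twistProj, MonoidHom.one_apply, one_smul]
  have hsum : ∑ n : N11 F, θ n⁻¹ * (i w).1 (antidiag 1 * (n : SL2 F) * antidiag 1) = 0 := by
    have hzero : (twistProj (principalSeries 1) (N11 F) θ (i (τ (antidiag 1) w))).1
        (antidiag 1) = 0 := by
      rw [← map_twistProj, hsub, map_zero]
      rfl
    rw [twistProj_induced_apply] at hzero
    simpa only [hrep, smul_eq_mul] using hzero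
  have hconst := eq_one_of_borel_invariant_of_sum_eq_zero (hB w) hN hθ hsum
  refine fun g => hi ?_
  ext x
  rw [hrep, hconst, hconst x]

end Steinberg

section Cuspidal

variable {F : Type*} [Field F] [Fintype F] {V : Type*} [AddCommGroup V] [Module ℂ V]
  (τ : Representation ℂ (SL2 F) V)

theorem sum_twistProj_psiN11 {ψ₀ : AddChar F ℂ} (hψ₀ : ψ₀ ≠ 1) (v : V) :
    ∑ c : F, twistProj τ (N11 F) (psiN11 ψ₀ c) v = (Fintype.card F : ℂ) • v := by
  classical
  have := Fintype.ofFinite (N11 F)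
  have hsum : ∀ u : F, ∑ c : F, psiN11 ψ₀ c (unipN u)⁻¹ • τ (unipN u : SL2 F) v =
      if u = 0 then (Fintype.card F : ℂ) • v else 0 := by
    intro u
    simp only [← unipN_neg, psiN11_unipN, ← Finset.sum_smul]
    rw [AddChar.sum_mulShift (-u) (AddChar.IsPrimitive.of_ne_one hψ₀)]
    split_ifs with hneg hu hu
    · simp [hu, unipN_zero]
    · exact absurd (neg_eq_zero.1 hneg) hu
    · exact absurd (neg_eq_zero.2 hu) hneg
    · simp
  simp only [twistProj_apply, ← Equiv.sum_comp unipEquiv, unipEquiv_apply]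
  rw [Finset.sum_comm]
  simp only [hsum, Finset.sum_ite_eq', Finset.mem_univ, if_true]

theorem finrank_le_sum_finrank_jacquetSpace [FiniteDimensional ℂ V] {ψ₀ : AddChar F ℂ}
    (hψ₀ : ψ₀ ≠ 1) : Module.finrank ℂ V ≤
      ∑ c : F, Module.finrank ℂ (JacquetSpace τ (N11 F) (psiN11 ψ₀ c)) := by
  let toJacquet : V →ₗ[ℂ] ∀ c : F, JacquetSpace τ (N11 F) (psiN11 ψ₀ c) :=
    LinearMap.pi fun c => (twistedKer τ (N11 F) (psiN11 ψ₀ c)).mkQ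
  have hinj : Function.Injective toJacquet := by
    refine (injective_iff_map_eq_zero toJacquet).2 fun v hv => ?_
    have hzero : ∀ c, twistProj τ (N11 F) (psiN11 ψ₀ c) v = 0 := fun c => by
      rw [← LinearMap.mem_ker, ker_twistProj]
      exact (Submodule.Quotient.mk_eq_zero _).1 (congrFun hv c)
    have hcard := sum_twistProj_psiN11 τ hψ₀ v
    simpa [hzero] using hcard.symm
  exact (LinearMap.finrank_le_finrank_of_injective hinj).trans_eq (Module.finrank_pi_fintype ℂ)

variable {τ}

theorem nontrivial_jacquetSpace_of_isCuspidal [τ.IsIrreducible] (hτ : IsCuspidal τ)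
    (hdim : Module.finrank ℂ V + 1 = Fintype.card F) {ψ₀ : AddChar F ℂ} (hψ₀ : ψ₀ ≠ 1)
    (c : Fˣ) : Nontrivial (JacquetSpace τ (N11 F) (psiN11 ψ₀ (c : F))) := by
  classical
  have := finiteDimensional_of_isIrreducible τ
  by_contra hsub
  rw [not_nontrivial_iff_subsingleton] at hsub
  let s : Finset F := {0, (c : F)}ᶜ
  have hvanish : ∀ a ∉ s, Module.finrank ℂ (JacquetSpace τ (N11 F) (psiN11 ψ₀ a)) = 0 := by
    intro a ha
    have ha' : a = 0 ∨ a = c := by simpa [s, or_iff_not_imp_left] using ha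
    rcases ha' with rfl | rfl
    · rw [psiN11_zero]
      exact (Module.finrank_zero_iff (R := ℂ)).2 hτ
    · exact Module.finrank_zero_of_subsingleton
  have hle : ∀ a ∈ s, Module.finrank ℂ (JacquetSpace τ (N11 F) (psiN11 ψ₀ a)) ≤ 1 := by
    intro a ha
    have ha0 : a ≠ 0 := fun h => by simp [s, h] at ha
    exact finrank_jacquetSpace_le_one τ (psiN11_ne_one hψ₀ (Units.mk0 a ha0))
  have hcard : s.card + 2 = Fintype.card F := by
    rw [← Finset.card_pair c.ne_zero.symm, Finset.card_compl_add_card]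
  have hbound : Module.finrank ℂ V ≤ s.card :=
    calc Module.finrank ℂ V ≤ ∑ a, Module.finrank ℂ (JacquetSpace τ (N11 F) (psiN11 ψ₀ a)) :=
          finrank_le_sum_finrank_jacquetSpace τ hψ₀
      _ = ∑ a ∈ s, Module.finrank ℂ (JacquetSpace τ (N11 F) (psiN11 ψ₀ a)) :=
          (Finset.sum_subset (Finset.subset_univ s) fun a _ ha => hvanish a ha).symm
      _ ≤ s.card := by simpa using Finset.sum_le_card_nsmul s _ 1 hle
  lia

end Cuspidal

section Sp4Elements

variable {F : Type*} [Field F]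

/-- The matrix of an element of `Sp₄`. -/
abbrev entries (g : Sp4 F) : Matrix (Fin 2 ⊕ Fin 2) (Fin 2 ⊕ Fin 2) F := g

/-- The element of `N` with upper right block `[a, b; b, c]`. -/
def siegelU (a b c : F) : Sp4 F :=
  ⟨Matrix.fromBlocks 1 !![a, b; b, c] 0 1, by
    rw [SymplecticGroup.fromBlocks_mem_iff]
    refine ⟨by simp, ?_, by simp⟩
    ext i j; fin_cases i <;> fin_cases j <;> simp⟩

/-- The permutation matrix exchanging the two coordinates. -/
def swapGL (F : Type*) [Field F] : GL (Fin 2) F :=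
  ⟨!![0, 1; 1, 0], !![0, 1; 1, 0],
    by ext i j; fin_cases i <;> fin_cases j <;> simp [Matrix.mul_apply, Fin.sum_univ_two],
    by ext i j; fin_cases i <;> fin_cases j <;> simp [Matrix.mul_apply, Fin.sum_univ_two]⟩

/-- The Weyl group element exchanging the two planes of the symplectic basis. -/
def weylW (F : Type*) [Field F] : Sp4 F := siegelLevi (swapGL F)

/-- The Weyl group element exchanging, up to sign, the two vectors of the first symplectic plane. -/
def weylS (F : Type*) [Field F] : Sp4 F :=
  ⟨Matrix.fromBlocks !![0, 0; 0, 1] !![1, 0; 0, 0] !![-1, 0; 0, 0] !![0, 0; 0, 1], by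
    rw [SymplecticGroup.fromBlocks_mem_iff]
    refine ⟨?_, ?_, ?_⟩ <;>
    · ext i j; fin_cases i <;> fin_cases j <;> simp [Matrix.mul_apply, Fin.sum_univ_two]⟩

/-- The lower triangular matrix with rows `(1, 0)` and `(y, d)`. -/
def lowerGL (y : F) (d : Fˣ) : GL (Fin 2) F :=
  ⟨!![1, 0; y, (d : F)], !![1, 0; -((d⁻¹ : Fˣ) : F) * y, ((d⁻¹ : Fˣ) : F)],
    by ext i j; fin_cases i <;> fin_cases j <;> simp [Matrix.mul_apply, Fin.sum_univ_two],
    by ext i j; fin_cases i <;> fin_cases j <;> simp [Matrix.mul_apply, Fin.sum_univ_two]⟩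

theorem lowerGL_mem_O2 (γ : Fˣ) (y : F) (d : Fˣ) : lowerGL y d ∈ O2 γ := by
  rw [mem_O2_iff]
  simp [lowerGL]

theorem siegelU_mem (a b c : F) : siegelU a b c ∈ siegelN F :=
  ⟨_, by ext i j; fin_cases i <;> fin_cases j <;> simp, rfl⟩

theorem exists_eq_siegelU (u : siegelN F) :
    ∃ a b c : F, u = ⟨siegelU a b c, siegelU_mem a b c⟩ := by
  obtain ⟨u, X, hX, hu⟩ := u
  refine ⟨X 0 0, X 0 1, X 1 1, Subtype.ext (Subtype.ext (hu.trans ?_))⟩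
  change _ = Matrix.fromBlocks 1 _ 0 1
  congr 1
  have h10 := hX.apply 0 1
  ext i j; fin_cases i <;> fin_cases j <;> simp [h10]

theorem psiC_siegelU (ψ₀ : AddChar F ℂ) (γ : Fˣ) (a b c : F) :
    psiC ψ₀ γ ⟨siegelU a b c, siegelU_mem a b c⟩ = ψ₀ (γ * a) := by
  change ψ₀ (matC γ * (Matrix.fromBlocks 1 !![a, b; b, c] 0 1).toBlocks₁₂).trace = _
  rw [Matrix.toBlocks_fromBlocks₁₂]
  simp [matC, Matrix.trace_fin_two]

theorem entries_mul (g h : Sp4 F) : entries (g * h) = entries g * entries h := rfl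

theorem entries_siegelU (a b c : F) :
    entries (siegelU a b c) = Matrix.fromBlocks 1 !![a, b; b, c] 0 1 := rfl

theorem entries_siegelLevi (h : GL (Fin 2) F) :
    entries (siegelLevi h) = Matrix.fromBlocks (h : Matrix (Fin 2) (Fin 2) F) 0 0
      ((h⁻¹ : GL (Fin 2) F) : Matrix (Fin 2) (Fin 2) F)ᵀ := rfl

theorem entries_weylW : entries (weylW F) =
    Matrix.fromBlocks !![0, 1; 1, 0] 0 0 !![0, 1; 1, 0]ᵀ := rfl

theorem entries_weylS : entries (weylS F) =
    Matrix.fromBlocks !![0, 0; 0, 1] !![1, 0; 0, 0] !![-1, 0; 0, 0] !![0, 0; 0, 1] := rfl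

theorem Sp4_ext_entries {g h : Sp4 F} (H : entries g = entries h) : g = h :=
  Subtype.ext H

theorem weylW_mul_siegelU (a b c : F) :
    weylW F * siegelU a b c = siegelU c b a * weylW F := by
  refine Sp4_ext_entries ?_
  simp only [entries_mul, entries_weylW, entries_siegelU, Matrix.fromBlocks_multiply]
  congr 1 <;>
  · ext i j
    fin_cases i <;> fin_cases j <;> simp [Matrix.vecMul, dotProduct]

theorem weylS_mul_siegelU (c : F) :
    weylS F * siegelU 0 0 c = siegelU 0 0 c * weylS F := by
  refine Sp4_ext_entries ?_
  simp only [entries_mul, entries_weylS, entries_siegelU, Matrix.fromBlocks_multiply]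
  congr 1 <;>
  · ext i j
    fin_cases i <;> fin_cases j <;> simp

theorem weylW_mul_siegelLevi (h : GL (Fin 2) F) :
    weylW F * siegelLevi h = siegelLevi (swapGL F * h * (swapGL F)⁻¹) * weylW F := by
  rw [weylW, ← map_mul, ← map_mul, inv_mul_cancel_right]

theorem coe_swapGL_conj (h : GL (Fin 2) F) :
    (swapGL F * h * (swapGL F)⁻¹).1 = !![h.1 1 1, h.1 1 0; h.1 0 1, h.1 0 0] := by
  change !![0, 1; 1, 0] * h.1 * !![0, 1; 1, 0] = _
  ext i j
  fin_cases i <;> fin_cases j <;> simp [Matrix.mul_apply, Fin.sum_univ_two, Matrix.vecMul,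
    dotProduct]

theorem coe_inv_of_triangular {h : GL (Fin 2) F} {a d : Fˣ} (ha : h.1 0 0 = a) (hd : h.1 1 1 = d)
    (h0 : h.1 0 1 * h.1 1 0 = 0) : h⁻¹.1 = !![((a⁻¹ : Fˣ) : F), -h.1 0 1 / (a * d);
      -h.1 1 0 / (a * d), ((d⁻¹ : Fˣ) : F)] := by
  rw [Matrix.coe_units_inv, Matrix.inv_def, Matrix.adjugate_fin_two, Matrix.det_fin_two, h0,
    sub_zero, ha, hd, Ring.inverse_eq_inv']
  ext i j
  fin_cases i <;> fin_cases j <;> simp <;> field_simp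

end Sp4Elements

section KlingenRow

variable {F : Type*} [Field F]

/-- The third row of an element of `Sp₄`. Up to scalars it determines the coset in `Q \ Sp₄`, since
`Q` stabilizes the line of the first basis vector, equivalently its orthogonal hyperplane. -/
def klingenRow (g : Sp4 F) : Fin 2 ⊕ Fin 2 → F := entries g (Sum.inr 0)

theorem klingenRow_apply (g : Sp4 F) (j : Fin 2 ⊕ Fin 2) :
    klingenRow g j = entries g (Sum.inr 0) j := rfl

theorem klingenRow_one : klingenRow (1 : Sp4 F) = Pi.single (Sum.inr 0) 1 := by
  ext j
  rw [klingenRow_apply, Pi.single_comm, Pi.single_apply]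
  exact Matrix.one_apply

theorem klingenRow_mul (g h : Sp4 F) : klingenRow (g * h) = klingenRow g ᵥ* entries h := rfl

theorem klingenRow_ne_zero (g : Sp4 F) : klingenRow g ≠ 0 := by
  intro h0
  have h1 := klingenRow_mul g g⁻¹
  rw [mul_inv_cancel, h0, Matrix.zero_vecMul, klingenRow_one] at h1
  simpa using congrFun h1 (Sum.inr 0)

theorem klingenRow_weylW : klingenRow (weylW F) = Sum.elim ![0, 0] ![0, 1] := by
  ext i
  rw [klingenRow_apply, entries_weylW]
  rcases i with i | i <;> fin_cases i <;> simp

theorem klingenRow_weylS : klingenRow (weylS F) = Sum.elim ![-1, 0] ![0, 0] := by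
  ext i
  rw [klingenRow_apply, entries_weylS]
  rcases i with i | i <;> fin_cases i <;> simp

theorem klingenRow_siegelLevi (h : GL (Fin 2) F) :
    klingenRow (siegelLevi h) = Sum.elim ![0, 0] ![h⁻¹.1 0 0, h⁻¹.1 1 0] := by
  ext i
  rw [klingenRow_apply, entries_siegelLevi]
  rcases i with i | i <;> fin_cases i <;> simp

theorem klingenRow_weylS_mul_weylW_mul_siegelLevi (h : GL (Fin 2) F) :
    klingenRow (weylS F * weylW F * siegelLevi h) = Sum.elim ![-h.1 1 0, -h.1 1 1] ![0, 0] := by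
  rw [klingenRow_mul, klingenRow_mul, klingenRow_weylS, entries_weylW, entries_siegelLevi,
    Matrix.vecMul_fromBlocks, Matrix.vecMul_fromBlocks]
  ext i
  rcases i with i | i <;> fin_cases i <;> simp [Matrix.vecMul, dotProduct]

theorem klingenRow_weylS_mul_weylW :
    klingenRow (weylS F * weylW F) = Sum.elim ![0, -1] ![0, 0] := by
  simpa using klingenRow_weylS_mul_weylW_mul_siegelLevi (1 : GL (Fin 2) F)

theorem klingenRow_mul_siegelU (g : Sp4 F) (a b c : F) :
    klingenRow (g * siegelU a b c) = Sum.elim (klingenRow g ∘ Sum.inl)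
      ((klingenRow g ∘ Sum.inl) ᵥ* !![a, b; b, c] + klingenRow g ∘ Sum.inr) := by
  rw [klingenRow_mul, entries_siegelU, Matrix.vecMul_fromBlocks]
  simp

theorem exists_klingenRow_mul_siegelU {g : Sp4 F} (hx : klingenRow g ∘ Sum.inl ≠ 0) :
    ∃ a b c : F, klingenRow (g * siegelU a b c) = Sum.elim (klingenRow g ∘ Sum.inl) 0 := by
  simp only [klingenRow_mul_siegelU]
  generalize klingenRow g ∘ Sum.inr = y
  generalize klingenRow g ∘ Sum.inl = x at hx ⊢
  suffices h : ∃ a b c : F, x 0 * a + x 1 * b + y 0 = 0 ∧ x 0 * b + x 1 * c + y 1 = 0 by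
    obtain ⟨a, b, c, h0, h1⟩ := h
    refine ⟨a, b, c, congrArg (Sum.elim x) (funext fun i => ?_)⟩
    fin_cases i <;> simpa [Matrix.vecMul, dotProduct]
  by_cases hx0 : x 0 = 0
  · have hx1 : x 1 ≠ 0 := fun hx1 => hx (funext (Fin.forall_fin_two.2 ⟨hx0, hx1⟩))
    exact ⟨0, -y 0 / x 1, -y 1 / x 1, by rw [hx0]; field_simp; ring, by rw [hx0]; field_simp; ring⟩
  · exact ⟨(-y 0 - x 1 * (-y 1 / x 0)) / x 0, -y 1 / x 0, 0, by field_simp; ring,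
      by field_simp; ring⟩

theorem entries_inv_mulVec_e1 (g : Sp4 F) :
    entries g⁻¹ *ᵥ e1 F = -Matrix.J (Fin 2) F *ᵥ klingenRow g := by
  have hJ : Matrix.J (Fin 2) F *ᵥ e1 F = Pi.single (Sum.inr 0) 1 := by
    ext i
    rw [e1, Matrix.mulVec_single_one, Matrix.col_apply]
    rcases i with i | i <;> fin_cases i <;> simp [Matrix.J]
  have hinv : entries g⁻¹ = -Matrix.J (Fin 2) F * (entries g)ᵀ * Matrix.J (Fin 2) F :=
    SymplecticGroup.coe_inv g
  rw [hinv, ← Matrix.mulVec_mulVec, hJ, ← Matrix.mulVec_mulVec, Matrix.mulVec_single_one]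
  rfl

theorem mem_klingen_iff_klingenRow {q : Sp4 F} :
    q ∈ klingen F ↔ ∃ t : Fˣ, klingenRow q = t • klingenRow 1 := by
  have hJ : IsUnit (-Matrix.J (Fin 2) F) := by
    rw [IsUnit.neg_iff, Matrix.isUnit_iff_isUnit_det]
    exact Matrix.isUnit_det_J (Fin 2) F
  have he1 : e1 F = -Matrix.J (Fin 2) F *ᵥ klingenRow 1 := by
    rw [← entries_inv_mulVec_e1, inv_one]
    exact (Matrix.one_mulVec _).symm
  rw [← inv_mem_iff]
  refine exists_congr fun t => ?_
  change entries q⁻¹ *ᵥ e1 F = t • e1 F ↔ _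
  rw [entries_inv_mulVec_e1, he1, ← Matrix.mulVec_smul]
  exact (Matrix.mulVec_injective_of_isUnit hJ).eq_iff

theorem mul_inv_mem_klingen_iff {g h : Sp4 F} :
    g * h⁻¹ ∈ klingen F ↔ ∃ t : Fˣ, klingenRow g = t • klingenRow h := by
  rw [mem_klingen_iff_klingenRow]
  refine exists_congr fun t => ⟨fun H => ?_, fun H => ?_⟩
  · rw [← inv_mul_cancel_right g h, klingenRow_mul, H, Matrix.smul_vecMul, ← klingenRow_mul,
      one_mul]
  · rw [klingenRow_mul, H, Matrix.smul_vecMul, ← klingenRow_mul, mul_inv_cancel]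

theorem eq_zero_of_weylS_mul_siegelU_mem {a b c : F}
    (h : weylS F * siegelU a b c * (weylS F)⁻¹ ∈ klingen F) : a = 0 ∧ b = 0 := by
  obtain ⟨t, ht⟩ := mul_inv_mem_klingen_iff.1 h
  rw [klingenRow_mul_siegelU, klingenRow_weylS] at ht
  exact ⟨by simpa using congrFun ht (Sum.inr 0), by simpa using congrFun ht (Sum.inr 1)⟩

theorem eq_zero_of_weylS_mul_weylW_mul_siegelU_mem {a b c : F}
    (h : weylS F * weylW F * siegelU a b c * (weylS F * weylW F)⁻¹ ∈ klingen F) :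
    b = 0 ∧ c = 0 := by
  obtain ⟨t, ht⟩ := mul_inv_mem_klingen_iff.1 h
  rw [klingenRow_mul_siegelU, klingenRow_weylS_mul_weylW] at ht
  exact ⟨by simpa using congrFun ht (Sum.inr 0), by simpa using congrFun ht (Sum.inr 1)⟩

end KlingenRow

section KlingenAction

variable {F : Type*} [Field F] {V : Type*} [AddCommGroup V] [Module ℂ V] {η : Fˣ →* ℂˣ}
  {τ : Representation ℂ (SL2 F) V}

theorem klingenInflation_apply {q : klingen F} {t : Fˣ} {A : SL2 F}
    (ht : entries (q : Sp4 F) (Sum.inl 0) (Sum.inl 0) = t)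
    (hA : middleBlock (entries (q : Sp4 F)) = A.1) (v : V) :
    klingenInflation η τ q v = (η t : ℂ) • τ A v := by
  have hq1 : klingenGL1 q = t := Units.ext ht
  have hq2 : klingenSL2 q = A := Subtype.ext hA
  change ((η (klingenGL1 q) : ℂˣ) : ℂ) • τ (klingenSL2 q) v = _
  rw [hq1, hq2]

theorem siegelU_mem_klingen (a b c : F) : siegelU a b c ∈ klingen F := by
  rw [mem_klingen_iff_klingenRow]
  refine ⟨1, ?_⟩
  ext j
  rw [klingenRow_apply, entries_siegelU, one_smul, klingenRow_one]
  rcases j with j | j <;> fin_cases j <;> simp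

theorem klingenInflation_siegelU (a b c : F) (v : V) :
    klingenInflation η τ ⟨siegelU a b c, siegelU_mem_klingen a b c⟩ v = τ (unip c) v := by
  rw [klingenInflation_apply (t := 1) (A := unip c), map_one, Units.val_one, one_smul]
  · simp [entries_siegelU]
  · simp [entries_siegelU, middleBlock, unip]

variable (f : Representation.coindV (klingen F).subtype (klingenInflation η τ))

theorem coindV_siegelU_mul (a b c : F) (g : Sp4 F) :
    f.1 (siegelU a b c * g) = τ (unip c) (f.1 g) := by
  rw [← klingenInflation_siegelU (η := η) a b c]
  exact coindV_mul f ⟨_, siegelU_mem_klingen a b c⟩ g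

theorem coindV_siegelLevi_mul {h : GL (Fin 2) F} {a d : Fˣ} (ha : h.1 0 0 = a) (hd : h.1 1 1 = d)
    (h10 : h.1 1 0 = 0) (g : Sp4 F) :
    f.1 (siegelLevi h * g) = (η a : ℂ) • τ (torus d) (f.1 g) := by
  have hinv := coe_inv_of_triangular ha hd (by rw [h10, mul_zero])
  have hq : siegelLevi h ∈ klingen F := by
    refine mem_klingen_iff_klingenRow.2 ⟨a⁻¹, ?_⟩
    ext j
    rw [klingenRow_siegelLevi, klingenRow_one, hinv]
    rcases j with j | j <;> fin_cases j <;> simp [h10, Units.smul_def]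
  rw [← klingenInflation_apply (q := ⟨_, hq⟩) (η := η) (t := a) (A := torus d) _ _]
  · exact coindV_mul f ⟨_, hq⟩ g
  · simpa [entries_siegelLevi] using ha
  · simp [entries_siegelLevi, middleBlock, hinv, coe_torus, hd]

theorem entries_weylS_conj (h : GL (Fin 2) F) : entries (weylS F * siegelLevi h * (weylS F)⁻¹) =
    Matrix.fromBlocks !![h⁻¹.1 0 0, 0; 0, h.1 1 1] !![0, h⁻¹.1 1 0; -h.1 1 0, 0]
      !![0, -h.1 0 1; h⁻¹.1 0 1, 0] !![h.1 0 0, 0; 0, h⁻¹.1 1 1] := by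
  have hcomm : entries (weylS F * siegelLevi h) =
      (Matrix.fromBlocks !![h⁻¹.1 0 0, 0; 0, h.1 1 1] !![0, h⁻¹.1 1 0; -h.1 1 0, 0]
        !![0, -h.1 0 1; h⁻¹.1 0 1, 0] !![h.1 0 0, 0; 0, h⁻¹.1 1 1]) * entries (weylS F) := by
    rw [entries_mul, entries_weylS, entries_siegelLevi, Matrix.fromBlocks_multiply,
      Matrix.fromBlocks_multiply]
    congr 1 <;>
    · ext i j
      fin_cases i <;> fin_cases j <;> simp [Matrix.vecMul, dotProduct]
  have hinv : entries (weylS F) * entries (weylS F)⁻¹ = 1 := by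
    rw [← entries_mul, mul_inv_cancel]
    rfl
  rw [entries_mul, hcomm, mul_assoc, hinv, mul_one]

theorem coindV_weylS_mul {h : GL (Fin 2) F} {a d : Fˣ} (ha : h.1 0 0 = a) (hd : h.1 1 1 = d)
    (h01 : h.1 0 1 = 0) (g : Sp4 F) :
    f.1 (weylS F * siegelLevi h * g) = (η a⁻¹ : ℂ) • τ (torus d) (f.1 (weylS F * g)) := by
  have hinv := coe_inv_of_triangular ha hd (by rw [h01, zero_mul])
  have hq : weylS F * siegelLevi h * (weylS F)⁻¹ ∈ klingen F := by
    refine mem_klingen_iff_klingenRow.2 ⟨a, ?_⟩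
    ext j
    rw [klingenRow_apply, entries_weylS_conj, klingenRow_one]
    rcases j with j | j <;> fin_cases j <;> simp [h01, ha, Units.smul_def]
  rw [← klingenInflation_apply (q := ⟨_, hq⟩) (η := η) (t := a⁻¹) (A := torus d) _ _]
  · rw [← coindV_mul f ⟨_, hq⟩]
    exact congrArg f.1 (by group)
  · rw [entries_weylS_conj]
    simp [hinv]
  · rw [entries_weylS_conj]
    simp [middleBlock, hinv, coe_torus, hd, h01]

theorem coindV_weylW_mul {h : GL (Fin 2) F} {a d : Fˣ} (ha : h.1 0 0 = a) (hd : h.1 1 1 = d)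
    (h01 : h.1 0 1 = 0) (g : Sp4 F) :
    f.1 (weylW F * siegelLevi h * g) = (η d : ℂ) • τ (torus a) (f.1 (weylW F * g)) := by
  rw [weylW_mul_siegelLevi, mul_assoc]
  apply coindV_siegelLevi_mul <;> rw [coe_swapGL_conj] <;> simp [ha, hd, h01]

theorem coindV_weylS_mul_weylW_mul {h : GL (Fin 2) F} {a d : Fˣ} (ha : h.1 0 0 = a)
    (hd : h.1 1 1 = d) (h10 : h.1 1 0 = 0) (g : Sp4 F) :
    f.1 (weylS F * weylW F * siegelLevi h * g) =
      (η d⁻¹ : ℂ) • τ (torus a) (f.1 (weylS F * weylW F * g)) := by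
  rw [mul_assoc (weylS F), weylW_mul_siegelLevi, ← mul_assoc, mul_assoc _ (weylW F),
    mul_assoc (weylS F) (weylW F)]
  apply coindV_weylS_mul <;> rw [coe_swapGL_conj] <;> simp [ha, hd, h10]

end KlingenAction

section Vanishing

variable {F : Type*} [Field F] {V : Type*} [AddCommGroup V] [Module ℂ V] {η : Fˣ →* ℂˣ}
  {τ : Representation ℂ (SL2 F) V} {ψ₀ : AddChar F ℂ} {γ : Fˣ}
  (f : Representation.coindV (klingen F).subtype (klingenInflation η τ))

theorem coindV_eq_zero_of_klingenRow_eq_smul {g g₀ : Sp4 F} {t : F} (ht : t ≠ 0)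
    (hrow : klingenRow g = t • klingenRow g₀) (h : f.1 g₀ = 0) : f.1 g = 0 := by
  have hq : g * g₀⁻¹ ∈ klingen F := mul_inv_mem_klingen_iff.2 ⟨Units.mk0 t ht, hrow⟩
  have hmul := coindV_mul f ⟨_, hq⟩ g₀
  rw [h, map_zero] at hmul
  simpa using hmul

theorem coindV_siegelLevi_inv_eq_zero (hψ₀ : ψ₀ ≠ 1)
    (hf : ∀ (g : Sp4 F) (u : siegelN F), f.1 (g * u) = psiC ψ₀ γ u • f.1 g) (h : O2 γ) :
    f.1 (siegelLevi (h : GL (Fin 2) F))⁻¹ = 0 := by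
  obtain ⟨c, hc⟩ : ∃ c : F, ψ₀ (γ * c) ≠ 1 := by
    by_contra! hc
    refine hψ₀ (DFunLike.ext _ _ fun x => ?_)
    rw [← mul_inv_cancel_left₀ γ.ne_zero x, hc, AddChar.one_apply]
  obtain ⟨hmem, hchar⟩ := siegelLevi_mem_charStabilizer ψ₀ γ h
  have heq := hf (siegelLevi (h : GL (Fin 2) F))⁻¹ ⟨_, (hmem _).1 (siegelU_mem c 0 0)⟩
  rw [hchar ⟨_, siegelU_mem c 0 0⟩ _ rfl, psiC_siegelU] at heq
  simp only [← mul_assoc, inv_mul_cancel, one_mul] at heq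
  rw [coindV_siegelU_mul, show unip (0 : F) = 1 from congrArg Subtype.val unipN_zero, map_one,
    Module.End.one_apply] at heq
  have hsub : (ψ₀ (γ * c) - 1) • f.1 (siegelLevi (h : GL (Fin 2) F))⁻¹ = 0 := by
    rw [sub_smul, one_smul, ← heq, sub_self]
  exact (smul_eq_zero.1 hsub).resolve_left (sub_ne_zero.2 hc)

theorem coindV_eq_zero_of_mul_siegelU_eq_zero
    (hf : ∀ (g : Sp4 F) (u : siegelN F), f.1 (g * u) = psiC ψ₀ γ u • f.1 g) {g : Sp4 F} {a b c : F}
    (h : f.1 (g * siegelU a b c) = 0) : f.1 g = 0 := by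
  have heq := hf g ⟨_, siegelU_mem a b c⟩
  rw [h] at heq
  exact (smul_eq_zero.1 heq.symm).resolve_left ((Group.isUnit _).map (psiC ψ₀ γ)).ne_zero

theorem coindV_eq_zero_of_klingenRow_inl_eq_zero (hψ₀ : ψ₀ ≠ 1)
    (hf : ∀ (g : Sp4 F) (u : siegelN F), f.1 (g * u) = psiC ψ₀ γ u • f.1 g)
    (hw : f.1 (weylW F) = 0) {g : Sp4 F} {y : Fin 2 → F}
    (hg : klingenRow g = Sum.elim (0 : Fin 2 → F) y) : f.1 g = 0 := by
  by_cases hy0 : y 0 = 0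
  · refine coindV_eq_zero_of_klingenRow_eq_smul f (t := y 1) (fun hy1 => ?_) ?_ hw
    · refine klingenRow_ne_zero g (hg.trans ?_)
      ext j
      rcases j with j | j <;> fin_cases j <;> simp [hy0, hy1]
    · rw [hg, klingenRow_weylW]
      ext j
      rcases j with j | j <;> fin_cases j <;> simp [hy0]
  · refine coindV_eq_zero_of_klingenRow_eq_smul f hy0 ?_
      (coindV_siegelLevi_inv_eq_zero f hψ₀ hf ⟨_, lowerGL_mem_O2 γ (y 1 / y 0) 1⟩)
    rw [hg, ← map_inv, klingenRow_siegelLevi, inv_inv]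
    ext j
    rcases j with j | j <;> fin_cases j <;> simp [lowerGL, mul_div_cancel₀, hy0]

theorem coindV_eq_zero_of_klingenRow_inr_eq_zero (hs : f.1 (weylS F) = 0)
    (hsw : ∀ h : O2 γ, f.1 (weylS F * weylW F * siegelLevi (h : GL (Fin 2) F)) = 0)
    {g : Sp4 F} {x : Fin 2 → F} (hg : klingenRow g = Sum.elim x (0 : Fin 2 → F)) : f.1 g = 0 := by
  by_cases hx1 : x 1 = 0
  · refine coindV_eq_zero_of_klingenRow_eq_smul f (t := -x 0) (fun hx0 => ?_) ?_ hs
    · refine klingenRow_ne_zero g (hg.trans ?_)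
      ext j
      rcases j with j | j <;> fin_cases j <;> simp [neg_eq_zero.1 hx0, hx1]
    · rw [hg, klingenRow_weylS]
      ext j
      rcases j with j | j <;> fin_cases j <;> simp [hx1]
  · refine coindV_eq_zero_of_klingenRow_eq_smul f (t := -1) (by simp) ?_
      (hsw ⟨_, lowerGL_mem_O2 γ (x 0) (Units.mk0 _ hx1)⟩)
    rw [hg, klingenRow_weylS_mul_weylW_mul_siegelLevi]
    ext j
    rcases j with j | j <;> fin_cases j <;> simp [lowerGL]

theorem coindV_eq_zero (hψ₀ : ψ₀ ≠ 1)
    (hf : ∀ (g : Sp4 F) (u : siegelN F), f.1 (g * u) = psiC ψ₀ γ u • f.1 g)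
    (hw : f.1 (weylW F) = 0) (hs : f.1 (weylS F) = 0)
    (hsw : ∀ h : O2 γ, f.1 (weylS F * weylW F * siegelLevi (h : GL (Fin 2) F)) = 0) : f = 0 := by
  refine Subtype.ext (funext fun g => ?_)
  change f.1 g = 0
  by_cases hx : klingenRow g ∘ Sum.inl = 0
  · refine coindV_eq_zero_of_klingenRow_inl_eq_zero f hψ₀ hf hw (y := klingenRow g ∘ Sum.inr) ?_
    rw [← hx, Sum.elim_comp_inl_inr]
  · obtain ⟨a, b, c, hrow⟩ := exists_klingenRow_mul_siegelU hx
    exact coindV_eq_zero_of_mul_siegelU_eq_zero f hf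
      (coindV_eq_zero_of_klingenRow_inr_eq_zero f hs hsw hrow)

end Vanishing

section JacquetQuotient

variable {G : Type*} [Group G] {V : Type*} [AddCommGroup V] [Module ℂ V]
  (ρ : Representation ℂ G V) (U : Subgroup G) (θ : U →* ℂ)

theorem mkQ_twistedKer_rep (u : U) (v : V) :
    (twistedKer ρ U θ).mkQ (ρ (u : G) v) = θ u • (twistedKer ρ U θ).mkQ v := by
  rw [← map_smul, ← sub_eq_zero, ← map_sub]
  exact (Submodule.Quotient.mk_eq_zero _).2 (Submodule.subset_span ⟨u, v, rfl⟩)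

variable {ρ U θ} in
theorem eq_zero_of_mem_twistedKer [Finite U] {v : V} (hv : ∀ u : U, ρ (u : G) v = θ u • v)
    (hmem : v ∈ twistedKer ρ U θ) : v = 0 := by
  rw [← ker_twistProj, LinearMap.mem_ker, twistProj_eq_card_smul ρ U θ hv] at hmem
  exact (smul_eq_zero.1 hmem).resolve_left (by exact_mod_cast Nat.card_pos.ne')

theorem center_le_charStabilizer : Subgroup.center G ≤ charStabilizer U θ := by
  intro z hz
  have hconj (g : G) : z * g * z⁻¹ = g := by
    rw [← Subgroup.mem_center_iff.1 hz g, mul_inv_cancel_right]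
  refine ⟨fun u => by rw [hconj], fun u u' h => ?_⟩
  rw [hconj] at h
  rw [Subtype.ext h]

/-- The action of the center of `G` on the twisted Jacquet module. -/
def centerJacquet : Representation ℂ (Subgroup.center G) (JacquetSpace ρ U θ) :=
  (jacquet ρ U θ).comp (Subgroup.inclusion (center_le_charStabilizer U θ))

variable {ρ U θ} in
theorem nonempty_jacquet_comp_equiv {H : Type*} [Group H] (ι : H →* charStabilizer U θ)
    {W : Type*} [AddCommGroup W] [Module ℂ W] {σ : Representation ℂ H W}
    (f : Representation.IntertwiningMap (ρ.comp ((charStabilizer U θ).subtype.comp ι)) σ)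
    (hker : LinearMap.ker f.toLinearMap = twistedKer ρ U θ) (hf : Function.Surjective f) :
    Nonempty (Representation.Equiv ((jacquet ρ U θ).comp ι) σ) := by
  let e : JacquetSpace ρ U θ ≃ₗ[ℂ] W := (Submodule.quotEquivOfEq _ _ hker.symm).trans
    (f.toLinearMap.quotKerEquivOfSurjective hf)
  refine ⟨.mk e fun h => LinearMap.ext fun x => ?_⟩
  obtain ⟨v, rfl⟩ := Submodule.mkQ_surjective _ x
  exact f.isIntertwining _ _ h v

end JacquetQuotient

section Decomposition

variable {F : Type*} [Field F] {V : Type*} [AddCommGroup V] [Module ℂ V]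
  (ψ₀ : AddChar F ℂ) (γ : Fˣ) (η : Fˣ →* ℂˣ) (τ : Representation ℂ (SL2 F) V)

/-- The `ψ_γ`-twisted Jacquet module of `τ` as a representation of `T₂`: `diag(a, d)` acts by
`η(d)` times the action of the central element `a I₂` of `SL₂`. -/
def whittakerT2 : Representation ℂ (T2 γ) (JacquetSpace τ (N11 F) (psiN11 ψ₀ γ)) :=
  charTwist (η.comp ((o2d γ).comp (T2 γ).subtype))
    ((centerJacquet τ (N11 F) (psiN11 ψ₀ γ)).comp (t2ToCenter γ))

/-- The inflation of `whittakerT2` to `O₂`. -/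
abbrev whittakerO2 : Representation ℂ (O2 γ) (JacquetSpace τ (N11 F) (psiN11 ψ₀ γ)) :=
  (whittakerT2 ψ₀ γ η τ).comp (o2ToT2 γ)

theorem whittakerT2_mkQ (t : T2 γ) (v : V) :
    whittakerT2 ψ₀ γ η τ t ((twistedKer τ (N11 F) (psiN11 ψ₀ γ)).mkQ v) =
      (η (o2d γ t) : ℂ) •
        (twistedKer τ (N11 F) (psiN11 ψ₀ γ)).mkQ (τ (torus (o2a γ (t : O2 γ))) v) := rfl

theorem o2a_o2ToT2 (h : O2 γ) : o2a γ (o2ToT2 γ h) = o2a γ h := Units.ext rfl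

theorem o2d_o2ToT2 (h : O2 γ) : o2d γ (o2ToT2 γ h) = o2d γ h := Units.ext rfl

theorem rho1_mkQ (h : O2 γ) (v : V) :
    rho1 γ η τ h ((twistedKer τ (N11 F) 1).mkQ v) =
      (η (o2a γ h) : ℂ) • (twistedKer τ (N11 F) 1).mkQ (τ (torus (o2d γ h)) v) := by
  rw [← o2a_o2ToT2, ← o2d_o2ToT2]
  rfl

/-- The restriction to `O₂` of a representation of `Sp₄`. -/
abbrev resO2 {X : Type*} [AddCommGroup X] [Module ℂ X] (π : Representation ℂ (Sp4 F) X) :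
    Representation ℂ (O2 γ) X :=
  π.comp (siegelLevi.comp (O2 γ).subtype)

variable [Finite F]

/-- Evaluation at `g` of the projection of a function in `Π` to its `(N, ψ_C)`-equivariant part. -/
def klingenEval (g : Sp4 F) :
    Representation.coindV (klingen F).subtype (klingenInflation η τ) →ₗ[ℂ] V :=
  LinearMap.proj g ∘ₗ Submodule.subtype _ ∘ₗ
    twistProj (klingenInd η τ) (siegelN F) (psiC ψ₀ γ)

variable {η τ} (f : Representation.coindV (klingen F).subtype (klingenInflation η τ))

theorem klingenEval_apply (g : Sp4 F) : klingenEval ψ₀ γ η τ g f =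
    (twistProj (klingenInd η τ) (siegelN F) (psiC ψ₀ γ) f).1 g := rfl

variable {ψ₀ γ}

theorem klingenEval_rep (h : O2 γ) (g : Sp4 F) :
    klingenEval ψ₀ γ η τ g (resO2 γ (klingenInd η τ) h f) =
      klingenEval ψ₀ γ η τ (g * siegelLevi (h : GL (Fin 2) F)) f :=
  congrFun (congrArg Subtype.val
    (twistProj_rep_of_mem_charStabilizer _ _ _ (siegelLevi_mem_charStabilizer ψ₀ γ h) f)) g

theorem klingenEval_mul_siegelU (g : Sp4 F) (a b c : F) :
    klingenEval ψ₀ γ η τ (g * siegelU a b c) f = ψ₀ (γ * a) • klingenEval ψ₀ γ η τ g f := by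
  rw [← psiC_siegelU ψ₀ γ a b c]
  exact twistProj_induced_mul _ _ _ f g ⟨_, siegelU_mem a b c⟩

theorem klingenEval_inducedDelta_eq_zero {g g₀ : Sp4 F} (v : V)
    (h : ∀ t : Fˣ, klingenRow g ∘ Sum.inl ≠ t • (klingenRow g₀ ∘ Sum.inl)) :
    klingenEval ψ₀ γ η τ g (inducedDelta (klingen F) (klingenInflation η τ) g₀ v) = 0 := by
  refine twistProj_inducedDelta_eq_zero _ _ _ v fun u hu hmem => ?_
  obtain ⟨a, b, c, hu'⟩ := exists_eq_siegelU ⟨u, hu⟩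
  obtain ⟨t, ht⟩ := mul_inv_mem_klingen_iff.1 hmem
  rw [show u = siegelU a b c from congrArg Subtype.val hu', klingenRow_mul_siegelU] at ht
  exact h t (congrArg (· ∘ Sum.inl) ht)

theorem rep_klingenEval_weylW (u : N11 F) : τ (u : SL2 F) (klingenEval ψ₀ γ η τ (weylW F) f) =
    psiN11 ψ₀ γ u • klingenEval ψ₀ γ η τ (weylW F) f := by
  obtain ⟨c, rfl⟩ := exists_unipN u
  rw [coe_unipN, psiN11_unipN, ← klingenEval_mul_siegelU f (weylW F) c 0 0, weylW_mul_siegelU]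
  exact (coindV_siegelU_mul _ 0 0 c _).symm

theorem rep_klingenEval_weylS (u : N11 F) : τ (u : SL2 F) (klingenEval ψ₀ γ η τ (weylS F) f) =
    (1 : N11 F →* ℂ) u • klingenEval ψ₀ γ η τ (weylS F) f := by
  obtain ⟨c, rfl⟩ := exists_unipN u
  have h := klingenEval_mul_siegelU (ψ₀ := ψ₀) (γ := γ) f (weylS F) 0 0 c
  rw [weylS_mul_siegelU, mul_zero, AddChar.map_zero_eq_one] at h
  exact (coindV_siegelU_mul _ 0 0 c _).symm.trans h

theorem rep_klingenEval_weylS_mul_weylW (u : N11 F) :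
    τ (u : SL2 F) (klingenEval ψ₀ γ η τ (weylS F * weylW F) f) =
      psiN11 ψ₀ γ u • klingenEval ψ₀ γ η τ (weylS F * weylW F) f := by
  obtain ⟨c, rfl⟩ := exists_unipN u
  rw [coe_unipN, psiN11_unipN, ← klingenEval_mul_siegelU f (weylS F * weylW F) c 0 0, mul_assoc,
    weylW_mul_siegelU, ← mul_assoc, weylS_mul_siegelU, mul_assoc]
  exact (coindV_siegelU_mul _ 0 0 c _).symm

variable (ψ₀ γ η τ)

/-- The component of the Jacquet module of `Π` supported on the double coset of `weylW`. -/
def weylWComponent : (resO2 γ (klingenInd η τ)).IntertwiningMap (whittakerO2 ψ₀ γ η τ) where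
  toLinearMap := (twistedKer τ (N11 F) (psiN11 ψ₀ γ)).mkQ ∘ₗ klingenEval ψ₀ γ η τ (weylW F)
  isIntertwining' h := LinearMap.ext fun f => by
    change _ = whittakerT2 ψ₀ γ η τ (o2ToT2 γ h) (Submodule.mkQ _ _)
    have hval := coindV_weylW_mul (twistProj (klingenInd η τ) (siegelN F) (psiC ψ₀ γ) f)
      (a := o2a γ h) (d := o2d γ h) rfl rfl ((mem_O2_iff γ _).1 h.2).2 1
    rw [mul_one, mul_one] at hval
    rw [whittakerT2_mkQ, o2a_o2ToT2, o2d_o2ToT2, ← map_smul, LinearMap.comp_apply,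
      LinearMap.comp_apply, klingenEval_rep]
    exact congrArg _ hval

/-- The component of the Jacquet module of `Π` supported on the double coset of `weylS`. -/
def weylSComponent : (resO2 γ (klingenInd η τ)).IntertwiningMap (rho1 γ η τ) where
  toLinearMap := (twistedKer τ (N11 F) 1).mkQ ∘ₗ klingenEval ψ₀ γ η τ (weylS F)
  isIntertwining' h := LinearMap.ext fun f => by
    change _ = rho1 γ η τ h (Submodule.mkQ _ _)
    have hval := coindV_weylS_mul (twistProj (klingenInd η τ) (siegelN F) (psiC ψ₀ γ) f)
      (a := o2a γ h) (d := o2d γ h) rfl rfl ((mem_O2_iff γ _).1 h.2).2 1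
    rw [mul_one, mul_one] at hval
    rw [rho1_mkQ, ← map_smul, LinearMap.comp_apply, LinearMap.comp_apply, klingenEval_rep]
    exact congrArg _ hval

/-- The component of the Jacquet module of `Π` supported on the double cosets of
`weylS * weylW * h`, `h ∈ O₂`. -/
def openComponent : (resO2 γ (klingenInd η τ)).IntertwiningMap
    (induced (T2 γ) (whittakerT2 ψ₀ γ η⁻¹ τ)) where
  toLinearMap := LinearMap.codRestrict _
    (LinearMap.pi fun h : O2 γ => (twistedKer τ (N11 F) (psiN11 ψ₀ γ)).mkQ ∘ₗ
      klingenEval ψ₀ γ η τ (weylS F * weylW F * siegelLevi (h : GL (Fin 2) F)))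
    fun f => by
      rw [Representation.mem_coindV]
      intro t h
      have hmul : siegelLevi (((T2 γ).subtype t * h : O2 γ) : GL (Fin 2) F) =
        siegelLevi ((t : O2 γ) : GL (Fin 2) F) * siegelLevi (h : GL (Fin 2) F) := map_mul _ _ _
      have hval := coindV_weylS_mul_weylW_mul
        (twistProj (klingenInd η τ) (siegelN F) (psiC ψ₀ γ) f) (a := o2a γ t) (d := o2d γ t)
        rfl rfl t.2 (siegelLevi (h : GL (Fin 2) F))
      simp only [LinearMap.pi_apply, LinearMap.comp_apply]
      rw [hmul, ← mul_assoc, klingenEval_apply, hval, map_smul, whittakerT2_mkQ, map_inv]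
      rfl
  isIntertwining' h := LinearMap.ext fun f => Subtype.ext <| funext fun g => by
    change Submodule.mkQ _ (klingenEval ψ₀ γ η τ _ _) = Submodule.mkQ _ (klingenEval ψ₀ γ η τ _ f)
    rw [klingenEval_rep, mul_assoc, ← map_mul]
    rfl

/-- The three components of the Jacquet module of `Π` taken together. -/
def components : (resO2 γ (klingenInd η τ)).IntertwiningMap
    ((whittakerO2 ψ₀ γ η τ).prod
      ((rho1 γ η τ).prod (induced (T2 γ) (whittakerT2 ψ₀ γ η⁻¹ τ)))) :=
  (weylWComponent ψ₀ γ η τ).prod ((weylSComponent ψ₀ γ η τ).prod (openComponent ψ₀ γ η τ))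

theorem openComponent_apply (h : O2 γ) : (openComponent ψ₀ γ η τ f).1 h =
    (twistedKer τ (N11 F) (psiN11 ψ₀ γ)).mkQ
      (klingenEval ψ₀ γ η τ (weylS F * weylW F * siegelLevi (h : GL (Fin 2) F)) f) := rfl

variable {ψ₀ γ η τ} in
theorem components_eq_zero_iff (hψ₀ : ψ₀ ≠ 1) :
    components ψ₀ γ η τ f = 0 ↔ twistProj (klingenInd η τ) (siegelN F) (psiC ψ₀ γ) f = 0 := by
  constructor
  · intro hf
    refine coindV_eq_zero _ hψ₀ (twistProj_induced_mul _ _ _ f) ?_ ?_ fun h => ?_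
    · exact eq_zero_of_mem_twistedKer (rep_klingenEval_weylW f)
        ((Submodule.Quotient.mk_eq_zero _).1 (congrArg Prod.fst hf))
    · exact eq_zero_of_mem_twistedKer (rep_klingenEval_weylS f)
        ((Submodule.Quotient.mk_eq_zero _).1 (congrArg (fun x => x.2.1) hf))
    · rw [← klingenEval_apply, ← klingenEval_rep]
      refine eq_zero_of_mem_twistedKer (rep_klingenEval_weylS_mul_weylW _)
        ((Submodule.Quotient.mk_eq_zero _).1 ?_)
      rw [klingenEval_rep]
      exact congrFun (congrArg (fun x => x.2.2.1) hf) h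
  · intro hf
    have heval (g : Sp4 F) : klingenEval ψ₀ γ η τ g f = 0 := by
      rw [klingenEval_apply, hf]
      rfl
    refine Prod.ext ?_ (Prod.ext ?_ (Subtype.ext (funext fun h => ?_)))
    · exact congrArg (twistedKer τ (N11 F) (psiN11 ψ₀ γ)).mkQ (heval _)
    · exact congrArg (twistedKer τ (N11 F) 1).mkQ (heval _)
    · exact congrArg (twistedKer τ (N11 F) (psiN11 ψ₀ γ)).mkQ (heval _)

theorem exists_weylWComponent_eq (x : JacquetSpace τ (N11 F) (psiN11 ψ₀ γ)) :
    ∃ v, weylWComponent ψ₀ γ η τ (inducedDelta (klingen F) _ (weylW F) v) = x := by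
  refine exists_twistProj_inducedDelta_eq (klingenInflation η τ) (siegelN F) (psiC ψ₀ γ)
    (Submodule.mkQ_surjective _) (weylW F) (fun u q v hq => ?_) x
  obtain ⟨a, b, c, rfl⟩ := exists_eq_siegelU u
  rw [weylW_mul_siegelU, mul_inv_cancel_right] at hq
  rw [show q = ⟨_, siegelU_mem_klingen c b a⟩ from Subtype.ext hq, klingenInflation_siegelU,
    psiC_siegelU, ← psiN11_unipN, ← mkQ_twistedKer_rep, coe_unipN]

theorem exists_weylSComponent_eq (x : JacquetSpace τ (N11 F) 1) :
    ∃ v, weylSComponent ψ₀ γ η τ (inducedDelta (klingen F) _ (weylS F) v) = x := by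
  refine exists_twistProj_inducedDelta_eq (klingenInflation η τ) (siegelN F) (psiC ψ₀ γ)
    (Submodule.mkQ_surjective _) (weylS F) (fun u q v hq => ?_) x
  obtain ⟨a, b, c, rfl⟩ := exists_eq_siegelU u
  obtain ⟨rfl, rfl⟩ := eq_zero_of_weylS_mul_siegelU_mem (hq ▸ q.2)
  rw [weylS_mul_siegelU, mul_inv_cancel_right] at hq
  rw [show q = ⟨_, siegelU_mem_klingen 0 0 c⟩ from Subtype.ext hq, klingenInflation_siegelU,
    psiC_siegelU, mul_zero, AddChar.map_zero_eq_one, ← coe_unipN, mkQ_twistedKer_rep]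
  rfl

theorem exists_openComponent_eq_inducedDelta (x : JacquetSpace τ (N11 F) (psiN11 ψ₀ γ)) :
    ∃ v, openComponent ψ₀ γ η τ (inducedDelta (klingen F) _ (weylS F * weylW F) v) =
      inducedDelta (T2 γ) _ 1 x := by
  obtain ⟨v, hv⟩ := exists_twistProj_inducedDelta_eq (klingenInflation η τ) (siegelN F)
    (psiC ψ₀ γ) (Submodule.mkQ_surjective (twistedKer τ (N11 F) (psiN11 ψ₀ γ)))
    (weylS F * weylW F) (fun u q v hq => by
      obtain ⟨a, b, c, rfl⟩ := exists_eq_siegelU u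
      obtain ⟨rfl, rfl⟩ := eq_zero_of_weylS_mul_weylW_mul_siegelU_mem (hq ▸ q.2)
      rw [mul_assoc (weylS F), weylW_mul_siegelU, ← mul_assoc, weylS_mul_siegelU,
        mul_assoc _ (weylS F), mul_inv_cancel_right] at hq
      rw [show q = ⟨_, siegelU_mem_klingen 0 0 a⟩ from Subtype.ext hq, klingenInflation_siegelU,
        psiC_siegelU, ← psiN11_unipN, ← mkQ_twistedKer_rep, coe_unipN]) x
  refine ⟨v, (eq_inducedDelta_of_eq_zero fun h hh => ?_).trans ?_⟩
  · rw [openComponent_apply, klingenEval_inducedDelta_eq_zero, map_zero]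
    intro t ht
    refine hh (?_ : (h : GL (Fin 2) F).1 1 0 = 0)
    rw [klingenRow_weylS_mul_weylW_mul_siegelLevi, klingenRow_weylS_mul_weylW] at ht
    simpa using congrFun ht 0
  · rw [openComponent_apply, OneMemClass.coe_one, map_one, mul_one]
    exact congrArg _ hv

theorem exists_components_eq_weylW (x : JacquetSpace τ (N11 F) (psiN11 ψ₀ γ)) :
    ∃ f, components ψ₀ γ η τ f = (x, 0, 0) := by
  obtain ⟨v, hv⟩ := exists_weylWComponent_eq ψ₀ γ η τ x
  refine ⟨_, Prod.ext hv (Prod.ext ?_ (Subtype.ext (funext fun h => ?_)))⟩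
  · refine congrArg (twistedKer τ (N11 F) 1).mkQ
      (klingenEval_inducedDelta_eq_zero v fun t ht => ?_)
    rw [klingenRow_weylS, klingenRow_weylW] at ht
    simpa using congrFun ht 0
  · refine congrArg (twistedKer τ (N11 F) (psiN11 ψ₀ γ)).mkQ
      (klingenEval_inducedDelta_eq_zero v fun t ht =>
        (o2d γ h).ne_zero (?_ : (h : GL (Fin 2) F).1 1 1 = 0))
    rw [klingenRow_weylS_mul_weylW_mul_siegelLevi, klingenRow_weylW] at ht
    simpa using congrFun ht 1

theorem exists_components_eq_weylS (x : JacquetSpace τ (N11 F) 1) :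
    ∃ f, components ψ₀ γ η τ f = (0, x, 0) := by
  obtain ⟨v, hv⟩ := exists_weylSComponent_eq ψ₀ γ η τ x
  refine ⟨_, Prod.ext ?_ (Prod.ext hv (Subtype.ext (funext fun h => ?_)))⟩
  · refine congrArg (twistedKer τ (N11 F) (psiN11 ψ₀ γ)).mkQ
      (klingenEval_inducedDelta_eq_zero v fun t ht => ?_)
    rw [klingenRow_weylW, klingenRow_weylS] at ht
    simpa [Units.smul_def] using congrFun ht 0
  · refine congrArg (twistedKer τ (N11 F) (psiN11 ψ₀ γ)).mkQ
      (klingenEval_inducedDelta_eq_zero v fun t ht =>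
        (o2d γ h).ne_zero (?_ : (h : GL (Fin 2) F).1 1 1 = 0))
    rw [klingenRow_weylS_mul_weylW_mul_siegelLevi, klingenRow_weylS] at ht
    simpa using congrFun ht 1

theorem exists_components_eq_inducedDelta (x : JacquetSpace τ (N11 F) (psiN11 ψ₀ γ)) :
    ∃ f, components ψ₀ γ η τ f = (0, 0, inducedDelta (T2 γ) _ 1 x) := by
  obtain ⟨v, hv⟩ := exists_openComponent_eq_inducedDelta ψ₀ γ η τ x
  refine ⟨_, Prod.ext ?_ (Prod.ext ?_ hv)⟩
  · refine congrArg (twistedKer τ (N11 F) (psiN11 ψ₀ γ)).mkQ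
      (klingenEval_inducedDelta_eq_zero v fun t ht => ?_)
    rw [klingenRow_weylW, klingenRow_weylS_mul_weylW] at ht
    simpa [Units.smul_def] using congrFun ht 1
  · refine congrArg (twistedKer τ (N11 F) 1).mkQ
      (klingenEval_inducedDelta_eq_zero v fun t ht => ?_)
    rw [klingenRow_weylS, klingenRow_weylS_mul_weylW] at ht
    simpa using congrFun ht 0

theorem exists_components_eq_open
    (φ : Representation.coindV (T2 γ).subtype (whittakerT2 ψ₀ γ η⁻¹ τ)) :
    ∃ f, components ψ₀ γ η τ f = (0, 0, φ) := by
  let reached := (LinearMap.range (components ψ₀ γ η τ).toLinearMap).comap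
    (LinearMap.inr ℂ (JacquetSpace τ (N11 F) (psiN11 ψ₀ γ)) _ ∘ₗ
      LinearMap.inr ℂ (JacquetSpace τ (N11 F) 1) _)
  have htop : reached = ⊤ := by
    refine eq_top_of_inducedDelta_mem ?_ (exists_components_eq_inducedDelta ψ₀ γ η τ)
    rintro h φ ⟨f, hf⟩
    refine ⟨resO2 γ (klingenInd η τ) h f, ((components ψ₀ γ η τ).isIntertwining _ _ h f).trans ?_⟩
    refine (congrArg _ hf).trans (Prod.ext ?_ (Prod.ext ?_ rfl))
    · exact map_zero (whittakerO2 ψ₀ γ η τ h)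
    · exact map_zero (rho1 γ η τ h)
  exact (htop ▸ Submodule.mem_top : φ ∈ reached)

theorem components_surjective : Function.Surjective (components ψ₀ γ η τ) := by
  rintro ⟨x, y, φ⟩
  obtain ⟨f₁, h₁⟩ := exists_components_eq_weylW ψ₀ γ η τ x
  obtain ⟨f₂, h₂⟩ := exists_components_eq_weylS ψ₀ γ η τ y
  obtain ⟨f₃, h₃⟩ := exists_components_eq_open ψ₀ γ η τ φ
  exact ⟨f₁ + (f₂ + f₃), by simp [h₁, h₂, h₃]⟩

variable {ψ₀} in
theorem nonempty_jacquetC_klingenInd_equiv (hψ₀ : ψ₀ ≠ 1) :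
    Nonempty ((jacquetC ψ₀ γ (klingenInd η τ)).Equiv ((whittakerO2 ψ₀ γ η τ).prod
      ((rho1 γ η τ).prod (induced (T2 γ) (whittakerT2 ψ₀ γ η⁻¹ τ))))) := by
  have hker : LinearMap.ker (components ψ₀ γ η τ).toLinearMap =
      twistedKer (klingenInd η τ) (siegelN F) (psiC ψ₀ γ) :=
    (Submodule.ext fun f => components_eq_zero_iff f hψ₀).trans (ker_twistProj _ _ _)
  exact nonempty_jacquet_comp_equiv (o2Embed ψ₀ γ) (components ψ₀ γ η τ) hker
    (components_surjective ψ₀ γ η τ)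

end Decomposition

section Cases

variable {F : Type*} [Field F] [Finite F] {V : Type*} [AddCommGroup V] [Module ℂ V]
  {ψ₀ : AddChar F ℂ} {γ : Fˣ} {η : Fˣ →* ℂˣ} {τ : Representation ℂ (SL2 F) V}

theorem nonempty_jacquetC_equiv_rho1 (hψ₀ : ψ₀ ≠ 1)
    (h : Subsingleton (JacquetSpace τ (N11 F) (psiN11 ψ₀ γ))) :
    Nonempty ((jacquetC ψ₀ γ (klingenInd η τ)).Equiv (rho1 γ η τ)) := by
  obtain ⟨e⟩ := nonempty_jacquetC_klingenInd_equiv γ η τ hψ₀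
  obtain ⟨e₁⟩ := nonempty_prod_equiv_right (whittakerO2 ψ₀ γ η τ)
    ((rho1 γ η τ).prod (induced (T2 γ) (whittakerT2 ψ₀ γ η⁻¹ τ)))
  obtain ⟨e₂⟩ := nonempty_prod_equiv_left (rho1 γ η τ)
    (induced (T2 γ) (whittakerT2 ψ₀ γ η⁻¹ τ))
  exact ⟨e.trans (e₁.trans e₂)⟩

theorem subsingleton_jacquetSpace_klingenInd (hψ₀ : ψ₀ ≠ 1) (hτ : IsCuspidal τ)
    (h : Subsingleton (JacquetSpace τ (N11 F) (psiN11 ψ₀ γ))) :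
    Subsingleton (JacquetSpace (klingenInd η τ) (siegelN F) (psiC ψ₀ γ)) := by
  have : Subsingleton (JacquetSpace τ (N11 F) 1) := hτ
  obtain ⟨e⟩ := nonempty_jacquetC_equiv_rho1 (η := η) hψ₀ h
  exact e.toLinearEquiv.toEquiv.subsingleton

variable [τ.IsIrreducible]

theorem nonempty_whittakerT2_equiv (η : Fˣ →* ℂˣ) (hψ₀ : ψ₀ ≠ 1)
    (h : Nontrivial (JacquetSpace τ (N11 F) (psiN11 ψ₀ γ))) :
    Nonempty ((whittakerT2 ψ₀ γ η τ).Equiv (charRep (t2Char γ (centralCharacter τ) η))) := by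
  have := finiteDimensional_of_isIrreducible τ
  have hrank : Module.finrank ℂ (JacquetSpace τ (N11 F) (psiN11 ψ₀ γ)) = Module.finrank ℂ ℂ :=
    (le_antisymm (finrank_jacquetSpace_le_one τ (psiN11_ne_one hψ₀ γ)) Module.finrank_pos).trans
      (Module.finrank_self ℂ).symm
  refine ⟨.mk (LinearEquiv.ofFinrankEq _ _ hrank) fun t => LinearMap.ext fun x => ?_⟩
  obtain ⟨v, rfl⟩ := Submodule.mkQ_surjective _ x
  have hcentral : τ (torus (o2a γ (t : O2 γ))) v =
      (centralCharacter τ (t2ToCenter γ t) : ℂ) • v := centralCharacter_spec τ (t2ToCenter γ t) v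
  rw [LinearMap.comp_apply, whittakerT2_mkQ, hcentral, map_smul, map_smul, map_smul, smul_smul,
    LinearMap.comp_apply, charRep_apply, mul_comm]
  simp [t2Char]

theorem nonempty_jacquetC_equiv_mu1 (hψ₀ : ψ₀ ≠ 1)
    (h : Nontrivial (JacquetSpace τ (N11 F) (psiN11 ψ₀ γ))) :
    Nonempty ((jacquetC ψ₀ γ (klingenInd η τ)).Equiv (mu1 γ η τ)) := by
  obtain ⟨e⟩ := nonempty_jacquetC_klingenInd_equiv γ η τ hψ₀
  obtain ⟨e₀⟩ := nonempty_whittakerT2_equiv η hψ₀ h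
  obtain ⟨e₂⟩ := nonempty_whittakerT2_equiv η⁻¹ hψ₀ h
  exact ⟨e.trans (prodEquiv (compEquiv (o2ToT2 γ) e₀) (prodEquiv (.refl _) (inducedEquiv e₂)))⟩

theorem nonempty_jacquetC_equiv_mu2 (hψ₀ : ψ₀ ≠ 1) (hτ : IsCuspidal τ)
    (h : Nontrivial (JacquetSpace τ (N11 F) (psiN11 ψ₀ γ))) :
    Nonempty ((jacquetC ψ₀ γ (klingenInd η τ)).Equiv (mu2 γ η τ)) := by
  have : Subsingleton (JacquetSpace τ (N11 F) 1) := hτ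
  obtain ⟨e⟩ := nonempty_jacquetC_equiv_mu1 (η := η) hψ₀ h
  obtain ⟨e'⟩ := nonempty_prod_equiv_right (rho1 γ η τ) (induced (T2 γ) (rho2 γ η τ))
  exact ⟨e.trans (prodEquiv (.refl _) e')⟩

end Cases

end KlingenJacquet

end

open KlingenJacquet in
theorem mainTheorem5_general {F : Type*} [Field F] [Fintype F] (ψ₀ : AddChar F ℂ) (hψ₀ : ψ₀ ≠ 1)
    (γ : Fˣ) (η : Fˣ →* ℂˣ) {V : Type*} [AddCommGroup V] [Module ℂ V]
    (τ : Representation ℂ (SL2 F) V) (hτ : τ.IsIrreducible) :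
    (Module.finrank ℂ V = 1 → (Fintype.card F ≤ 3 → τ.IsTrivial) →
      Nonempty ((jacquetC ψ₀ γ (klingenInd η τ)).Equiv (rho1 γ η τ))) ∧
    (IsPrincipalSeries τ ∨ IsSteinberg τ →
      Nonempty ((jacquetC ψ₀ γ (klingenInd η τ)).Equiv (mu1 γ η τ))) ∧
    (IsCuspidal τ → Module.finrank ℂ V + 1 = Fintype.card F →
      Nonempty ((jacquetC ψ₀ γ (klingenInd η τ)).Equiv (mu2 γ η τ))) ∧
    (∀ Ψ Ψ' : N11 F →* ℂ, Ψ ≠ 1 → Ψ' ≠ 1 → ¬ InTorusOrbit Ψ Ψ' →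
      Nontrivial (JacquetSpace τ (N11 F) Ψ) → Subsingleton (JacquetSpace τ (N11 F) Ψ') →
      (InTorusOrbit Ψ (psiN11 ψ₀ γ) →
        Nonempty ((jacquetC ψ₀ γ (klingenInd η τ)).Equiv (mu1 γ η τ))) ∧
      (¬ InTorusOrbit Ψ (psiN11 ψ₀ γ) →
        Nonempty ((jacquetC ψ₀ γ (klingenInd η τ)).Equiv (rho1 γ η τ)))) ∧
    (∀ Ψ Ψ' : N11 F →* ℂ, Ψ ≠ 1 → Ψ' ≠ 1 → ¬ InTorusOrbit Ψ Ψ' → IsCuspidal τ →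
      Nontrivial (JacquetSpace τ (N11 F) Ψ) → Subsingleton (JacquetSpace τ (N11 F) Ψ') →
      (InTorusOrbit Ψ (psiN11 ψ₀ γ) →
        Nonempty ((jacquetC ψ₀ γ (klingenInd η τ)).Equiv (mu2 γ η τ))) ∧
      (¬ InTorusOrbit Ψ (psiN11 ψ₀ γ) →
        Subsingleton (JacquetSpace (klingenInd η τ) (siegelN F) (psiC ψ₀ γ)))) := by
  have hψγ := psiN11_ne_one hψ₀ γ
  have hother {Ψ Ψ' : N11 F →* ℂ} (hΨ : Ψ ≠ 1) (hΨ' : Ψ' ≠ 1) (hΨΨ' : ¬ InTorusOrbit Ψ Ψ')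
      (h : ¬ InTorusOrbit Ψ (psiN11 ψ₀ γ)) : InTorusOrbit Ψ' (psiN11 ψ₀ γ) :=
    (inTorusOrbit_or_inTorusOrbit hψ₀ hΨ hΨ' hψγ hΨΨ').resolve_left h
  refine ⟨fun hdim htriv => ?_, ?_, fun hc hdim => ?_,
    fun Ψ Ψ' hΨ hΨ' hΨΨ' hnt hss => ⟨fun h => ?_, fun h => ?_⟩,
    fun Ψ Ψ' hΨ hΨ' hΨΨ' hc hnt hss => ⟨fun h => ?_, fun h => ?_⟩⟩
  · exact nonempty_jacquetC_equiv_rho1 hψ₀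
      (subsingleton_jacquetSpace_of_finrank_eq_one hdim htriv hψγ)
  · rintro (hps | hst)
    · exact nonempty_jacquetC_equiv_mu1 hψ₀ (nontrivial_jacquetSpace_of_isPrincipalSeries hps _)
    · exact nonempty_jacquetC_equiv_mu1 hψ₀ (nontrivial_jacquetSpace_of_isSteinberg hst hψγ)
  · exact nonempty_jacquetC_equiv_mu2 hψ₀ hc (nontrivial_jacquetSpace_of_isCuspidal hc hdim hψ₀ γ)
  · exact nonempty_jacquetC_equiv_mu1 hψ₀ (nontrivial_jacquetSpace_of_inTorusOrbit h hnt)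
  · exact nonempty_jacquetC_equiv_rho1 hψ₀
      (subsingleton_jacquetSpace_of_inTorusOrbit (hother hΨ hΨ' hΨΨ' h) hss)
  · exact nonempty_jacquetC_equiv_mu2 hψ₀ hc (nontrivial_jacquetSpace_of_inTorusOrbit h hnt)
  · exact subsingleton_jacquetSpace_klingenInd hψ₀ hc
      (subsingleton_jacquetSpace_of_inTorusOrbit (hother hΨ hΨ' hΨΨ' h) hss)

theorem mainTheorem5 {F : Type*} [Field F] [Fintype F] (hF : ringChar F ≠ 2)
    (ψ₀ : AddChar F ℂ) (hψ₀ : ψ₀ ≠ 1) (γ : Fˣ) (η : Fˣ →* ℂˣ)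
    {V : Type*} [AddCommGroup V] [Module ℂ V]
    (τ : Representation ℂ (KlingenJacquet.SL2 F) V) (hτ : τ.IsIrreducible)
    (Ψ Ψ' : KlingenJacquet.N11 F →* ℂ) (hΨ : Ψ ≠ 1) (hΨ' : Ψ' ≠ 1)
    (hΨΨ' : ¬ KlingenJacquet.InTorusOrbit Ψ Ψ') :
    -- (1) `τ` one-dimensional (for `q = 3`: the trivial representation)
    (Module.finrank ℂ V = 1 → (Fintype.card F = 3 → τ.IsTrivial) →
      Nonempty ((KlingenJacquet.jacquetC ψ₀ γ (KlingenJacquet.klingenInd η τ)).Equiv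
        (KlingenJacquet.rho1 γ η τ))) ∧
    -- (2) `τ` an irreducible principal series representation or the special representation
    (KlingenJacquet.IsPrincipalSeries τ ∨ KlingenJacquet.IsSteinberg τ →
      Nonempty ((KlingenJacquet.jacquetC ψ₀ γ (KlingenJacquet.klingenInd η τ)).Equiv
        (KlingenJacquet.mu1 γ η τ))) ∧
    -- (3) `τ` cuspidal of dimension `q - 1`
    (KlingenJacquet.IsCuspidal τ → Module.finrank ℂ V + 1 = Fintype.card F →
      Nonempty ((KlingenJacquet.jacquetC ψ₀ γ (KlingenJacquet.klingenInd η τ)).Equiv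
        (KlingenJacquet.mu2 γ η τ))) ∧
    -- (4) `τ = τ₁`, the component of `Ind_B^{SL₂}(χ)`, `χ` of order two, that sees `Ψ`, not `Ψ'`
    (∀ χ : Fˣ →* ℂˣ, orderOf χ = 2 →
      KlingenJacquet.IsConstituent τ (KlingenJacquet.principalSeries χ) →
      Nontrivial (KlingenJacquet.JacquetSpace τ (KlingenJacquet.N11 F) Ψ) →
      Subsingleton (KlingenJacquet.JacquetSpace τ (KlingenJacquet.N11 F) Ψ') →
      (KlingenJacquet.InTorusOrbit Ψ (KlingenJacquet.psiN11 ψ₀ γ) →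
        Nonempty ((KlingenJacquet.jacquetC ψ₀ γ (KlingenJacquet.klingenInd η τ)).Equiv
          (KlingenJacquet.mu1 γ η τ))) ∧
      (¬ KlingenJacquet.InTorusOrbit Ψ (KlingenJacquet.psiN11 ψ₀ γ) →
        Nonempty ((KlingenJacquet.jacquetC ψ₀ γ (KlingenJacquet.klingenInd η τ)).Equiv
          (KlingenJacquet.rho1 γ η τ)))) ∧
    -- (5) `τ = τ₁'`, the cuspidal representation of dimension `(q - 1) / 2` that sees `Ψ`, not `Ψ'`
    (KlingenJacquet.IsCuspidal τ → 2 * Module.finrank ℂ V + 1 = Fintype.card F →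
      Nontrivial (KlingenJacquet.JacquetSpace τ (KlingenJacquet.N11 F) Ψ) →
      Subsingleton (KlingenJacquet.JacquetSpace τ (KlingenJacquet.N11 F) Ψ') →
      (KlingenJacquet.InTorusOrbit Ψ (KlingenJacquet.psiN11 ψ₀ γ) →
        Nonempty ((KlingenJacquet.jacquetC ψ₀ γ (KlingenJacquet.klingenInd η τ)).Equiv
          (KlingenJacquet.mu2 γ η τ))) ∧
      (¬ KlingenJacquet.InTorusOrbit Ψ (KlingenJacquet.psiN11 ψ₀ γ) →
        Subsingleton (KlingenJacquet.JacquetSpace (KlingenJacquet.klingenInd η τ)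
          (KlingenJacquet.siegelN F) (KlingenJacquet.psiC ψ₀ γ)))) := by
  obtain ⟨h₁, h₂, h₃, h₄, h₅⟩ := mainTheorem5_general ψ₀ hψ₀ γ η τ hτ
  have hodd := FiniteField.odd_card_of_char_ne_two hF
  have hcard := Fintype.one_lt_card (α := F)
  exact ⟨fun hdim htriv => h₁ hdim fun hle => htriv (by lia), h₂, h₃,
    fun _ _ _ => h₄ Ψ Ψ' hΨ hΨ' hΨΨ', fun hc _ => h₅ Ψ Ψ' hΨ hΨ' hΨΨ' hc⟩
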